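/- Let $k\ge 0$ be an integer, let $\mathbf F=\mathbb F_{2^{2k+1}}$ be a field with $2^{2k+1}$ elements, and let $\mathcal F\subset\mathbb P^3_{\mathbf F}$ be the Fermat cubic surface, i.e. the projective $\mathbf F$-scheme defined by the equation $$x^3+y^3+z^3+t^3=0 .$$ Then the group $\mathrm{Aut}(\mathcal F)$ of all automorphisms of $\mathcal F$ as a scheme over $\mathbf F$ is isomorphic to $\mathbb Z/2\mathbb Z\times\mathfrak S_4$, where $\mathfrak S_4$ is the symmetric group of degree $4$. -/

import Mathlib

open AlgebraicGeometry CategoryTheory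

noncomputable section

namespace FermatCubic

/-- The Fermat cubic form `x³ + y³ + z³ + t³` over a commutative ring `F`. -/
def form (F : Type*) [CommRing F] : MvPolynomial (Fin 4) F :=
  ∑ i : Fin 4, MvPolynomial.X i ^ 3

/-- The homogeneous coordinate ring `F[x, y, z, t] / (x³ + y³ + z³ + t³)`. -/
abbrev CoordRing (F : Type*) [CommRing F] : Type _ :=
  MvPolynomial (Fin 4) F ⧸ Ideal.span {form F}

/-- The standard grading of the homogeneous coordinate ring: the piece of degree `n` consists of
the classes of the homogeneous polynomials of degree `n`. -/
def grading (F : Type*) [CommRing F] (n : ℕ) : Submodule F (CoordRing F) :=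
  (MvPolynomial.homogeneousSubmodule (Fin 4) F n).map
    (Ideal.Quotient.mkₐ F (Ideal.span {form F})).toLinearMap

theorem mk_mem_grading {F : Type*} [CommRing F] {n : ℕ} {p : MvPolynomial (Fin 4) F}
    (hp : p.IsHomogeneous n) : Ideal.Quotient.mkₐ F (Ideal.span {form F}) p ∈ grading F n :=
  ⟨p, hp, rfl⟩

instance gradedMonoid (F : Type*) [CommRing F] : SetLike.GradedMonoid (grading F) where
  one_mem := ⟨1, MvPolynomial.isHomogeneous_one _ _, map_one (Ideal.Quotient.mkₐ F _)⟩
  mul_mem := by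
    rintro i j _ _ ⟨p, hp, rfl⟩ ⟨q, hq, rfl⟩
    exact ⟨p * q, MvPolynomial.IsHomogeneous.mul hp hq, map_mul (Ideal.Quotient.mkₐ F _) _ _⟩

/-- The decomposition of a polynomial into (classes of) homogeneous pieces, as the algebra
homomorphism that sends each variable to its class placed in degree one. -/
def polyDecompose (F : Type*) [CommRing F] :
    MvPolynomial (Fin 4) F →ₐ[F] DirectSum ℕ (fun n => grading F n) :=
  MvPolynomial.aeval fun i => DirectSum.of (fun n => grading F n) 1
    ⟨_, mk_mem_grading (MvPolynomial.isHomogeneous_X F i)⟩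

theorem coe_polyDecompose {F : Type*} [CommRing F] (p : MvPolynomial (Fin 4) F) :
    DirectSum.coeAlgHom (grading F) (polyDecompose F p) =
      Ideal.Quotient.mkₐ F (Ideal.span {form F}) p := by
  have : (DirectSum.coeAlgHom (grading F)).comp (polyDecompose F) =
      Ideal.Quotient.mkₐ F (Ideal.span {form F}) := by
    ext i
    simp [polyDecompose]
  exact DFunLike.congr_fun this p

theorem polyDecompose_monomial {F : Type*} [CommRing F] (s : Fin 4 →₀ ℕ) (c : F) :
    polyDecompose F (MvPolynomial.monomial s c) ∈
      (DirectSum.of (fun n => grading F n) s.degree).range := by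
  have hmul : ∀ {m n : ℕ} {a b : DirectSum ℕ (fun n => grading F n)},
      a ∈ (DirectSum.of (fun n => grading F n) m).range →
      b ∈ (DirectSum.of (fun n => grading F n) n).range →
      a * b ∈ (DirectSum.of (fun n => grading F n) (m + n)).range := by
    rintro m n _ _ ⟨a, rfl⟩ ⟨b, rfl⟩
    exact ⟨_, (DirectSum.of_mul_of (A := fun n => grading F n) a b).symm⟩
  have hC : ∀ c : F, polyDecompose F (MvPolynomial.C c) ∈
      (DirectSum.of (fun n => grading F n) 0).range := by
    intro c
    refine ⟨algebraMap F (grading F 0) c, ?_⟩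
    rw [← MvPolynomial.algebraMap_eq]
    exact ((polyDecompose F).commutes c).symm
  induction s using Finsupp.induction_linear generalizing c with
  | zero =>
    rw [map_zero]
    exact hC c
  | add s t hs ht =>
    have h : MvPolynomial.monomial (s + t) c =
        MvPolynomial.monomial s c * MvPolynomial.monomial t 1 := by simp
    rw [h, map_mul, map_add]
    exact hmul (hs c) (ht 1)
  | single i m =>
    rw [Finsupp.degree_single]
    induction m generalizing c with
    | zero => simpa using hC c
    | succ m ih =>
      have h : MvPolynomial.monomial (Finsupp.single i (m + 1)) c =
          MvPolynomial.monomial (Finsupp.single i m) c * MvPolynomial.X i := by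
        rw [MvPolynomial.X, MvPolynomial.monomial_mul, ← Finsupp.single_add, mul_one]
      rw [h, map_mul]
      refine hmul (ih c) ?_
      rw [polyDecompose, MvPolynomial.aeval_X]
      exact ⟨_, rfl⟩

theorem polyDecompose_of_isHomogeneous {F : Type*} [CommRing F] {n : ℕ}
    {p : MvPolynomial (Fin 4) F} (hp : p.IsHomogeneous n) :
    polyDecompose F p = DirectSum.of (fun n => grading F n) n ⟨_, mk_mem_grading hp⟩ := by
  have hmem : polyDecompose F p ∈ (DirectSum.of (fun n => grading F n) n).range := by
    rw [p.as_sum, map_sum]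
    refine sum_mem ?_
    intro s hs
    have h := polyDecompose_monomial s (p.coeff s)
    have hd : s.degree = n := by
      rw [Finsupp.degree_eq_weight_one]
      exact hp (MvPolynomial.mem_support_iff.1 hs)
    rwa [hd] at h
  obtain ⟨y, hy⟩ := hmem
  have h := coe_polyDecompose p
  rw [← hy, DirectSum.coeAlgHom_of] at h
  rw [← hy]
  congr 1
  exact Subtype.ext h

theorem form_isHomogeneous (F : Type*) [CommRing F] : (form F).IsHomogeneous 3 :=
  MvPolynomial.IsHomogeneous.sum _ _ _ fun i _ => by
    simpa using (MvPolynomial.isHomogeneous_X F i).pow 3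

theorem polyDecompose_form (F : Type*) [CommRing F] : polyDecompose F (form F) = 0 := by
  rw [polyDecompose_of_isHomogeneous (form_isHomogeneous F)]
  have h : (⟨_, mk_mem_grading (form_isHomogeneous F)⟩ : grading F 3) = 0 :=
    Subtype.ext (Ideal.Quotient.eq_zero_iff_mem.2 (Ideal.mem_span_singleton_self _))
  rw [h, map_zero]

/-- The homogeneous coordinate ring is a graded `F`-algebra for the standard grading. -/
instance gradedAlgebra (F : Type*) [CommRing F] : GradedAlgebra (grading F) :=
  GradedAlgebra.ofAlgHom (grading F)
    (Ideal.Quotient.liftₐ (Ideal.span {form F}) (polyDecompose F) (by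
      intro a ha
      obtain ⟨b, rfl⟩ := Ideal.mem_span_singleton'.1 ha
      rw [map_mul, polyDecompose_form, mul_zero]))
    (by
      refine AlgHom.ext fun a => ?_
      obtain ⟨p, rfl⟩ := Ideal.Quotient.mk_surjective a
      exact coe_polyDecompose p)
    (by
      rintro n ⟨_, p, hp, rfl⟩
      exact polyDecompose_of_isHomogeneous hp)

end FermatCubic

/-- The Fermat cubic surface `x³ + y³ + z³ + t³ = 0` in `ℙ³` over a field `F`, as a scheme over
`Spec F`: it is `Proj` of the graded ring `F[x, y, z, t] / (x³ + y³ + z³ + t³)`, with the structure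
morphism induced by the inclusion of the constants `F` into the degree zero part. -/
def fermatCubic (F : Type*) [Field F] : Over (Spec (CommRingCat.of F)) :=
  Over.mk (Proj.toSpecZero (FermatCubic.grading F) ≫
    Spec.map (CommRingCat.ofHom (algebraMap F (FermatCubic.grading F 0))))

end

/-!
The group `ℤ/2 × 𝔖₄` acts on the surface `X` by linear substitutions (`permShift`): `𝔖₄` permutes
the coordinates, and the involution adds `x₀ + x₁ + x₂ + x₃` to each of them. The latter preserves
the Fermat form because `∑ xᵢ² = (∑ xᵢ)²` in characteristic two. The resulting homomorphism
`symHom` from this group to `Aut X` is shown to be bijective.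

Injectivity compares the ratios of the coordinates: they determine a substitution, as no nonzero
quadratic form vanishes on `X` (`eq_one_of_surfaceMap_eq_id`).

For surjectivity, an automorphism of `X` extends to projective space because it acts on the sections
of the anticanonical sheaf, and this sheaf is `𝒪(1)`. Instead of the sheaf, its rational sections
are used: the alternating biderivations (`IsBiderivation`) of the function field `K`. An
automorphism of the integral scheme `X` induces an automorphism of `K` that
permutes the local rings of `X` in `K` and that determines it (`functionFieldMap`,
`eq_of_functionFieldMap_eq`). It therefore preserves the space of biderivations that are regular on
all local rings. This space is spanned by the products of the coordinates `xᵢ / x₃` with one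
explicit biderivation (`AffineCoords.IsStandard`, `IsStandard.exists_eq_sum_mul`): a biderivation is
an element `g` of `K` times the standard one, and regularity on the charts `x₀ ≠ 0` and `x₁ ≠ 0`
forces `g x₃` to be a linear form, because `x₀` is prime in the homogeneous coordinate ring. Hence
the automorphism is linear in the coordinates (`AffineCoords.exists_matrix`).

A matrix `A` that multiplies the form `∑ xᵢ³` by a constant `c` satisfies `Aᵀ A⁽²⁾ = c`, where
`A⁽²⁾` has the squares of the entries of `A` as entries (`transpose_mul_map_frobenius`). Cubing is
bijective on a field with `2 ^ (2 * k + 1)` elements, so one may take `c = 1`; then `A⁽⁴⁾ = A`, the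
entries are `0` or `1`, and `A` belongs to the orthogonal group of the standard form on `𝔽₂⁴`, which
consists of the substitutions above (`exists_perm_of_orthogonal`, `matrix_eq_smul_perm`).
-/

noncomputable section

namespace FermatCubic

/-! ### The homogeneous coordinate ring -/

section CoordinateRing

open MvPolynomial

variable {F : Type*} [Field F]

theorem prime_sum_X_pow_three [CharP F 2] (n : ℕ) :
    Prime (∑ i : Fin (n + 3), (X i : MvPolynomial (Fin (n + 3)) F) ^ 3) := by
  rw [← UniqueFactorizationMonoid.irreducible_iff_prime,
    ← MulEquiv.irreducible_iff (finSuccEquiv F (n + 2))]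
  set c : MvPolynomial (Fin (n + 2)) F := ∑ i, X i ^ 3 with hc
  have himg : finSuccEquiv F (n + 2) (∑ i : Fin (n + 3), X i ^ 3) =
      Polynomial.X ^ 3 + Polynomial.C c := by
    rw [Fin.sum_univ_succ, map_add, map_pow, finSuccEquiv_X_zero, map_sum, hc, map_sum]
    simp only [map_pow, finSuccEquiv_X_succ]
  rw [himg, Polynomial.Monic.irreducible_iff_roots_eq_zero_of_degree_le_three
    (Polynomial.monic_X_pow_add_C c three_ne_zero) (by rw [Polynomial.natDegree_X_pow_add_C]; simp)
    (by rw [Polynomial.natDegree_X_pow_add_C])]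
  refine Multiset.eq_zero_of_forall_notMem fun b hb => ?_
  have hroot : b ^ 3 + c = 0 := by simpa using (Polynomial.mem_roots'.1 hb).2
  -- Restrict to the line `(t, 1, 0, …, 0)` and differentiate at its point `t = 1` of the surface.
  let φ : MvPolynomial (Fin (n + 2)) F →ₐ[F] Polynomial F :=
    aeval (Fin.cons Polynomial.X (Fin.cons 1 0))
  have h2 : (2 : F) = 0 := CharTwo.two_eq_zero
  have hφc : φ c = Polynomial.X ^ 3 + 1 := by
    simp [φ, hc, Fin.sum_univ_succ]
  have h := congrArg φ hroot
  rw [map_add, hφc, map_pow, map_zero] at h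
  have h1 := congrArg (Polynomial.eval 1) h
  have hd := congrArg (fun q => Polynomial.eval 1 (Polynomial.derivative q)) h
  simp only [Polynomial.eval_add, Polynomial.eval_pow, Polynomial.eval_X, Polynomial.eval_one,
    Polynomial.eval_zero, one_pow, one_add_one_eq_two, h2, add_zero, pow_eq_zero_iff,
    ne_eq, OfNat.ofNat_ne_zero, not_false_eq_true] at h1
  simp [Polynomial.derivative_pow, h1] at hd
  have : (3 : F) = 2 + 1 := by norm_num
  rw [this, h2] at hd
  simp at hd

theorem prime_form [CharP F 2] : Prime (form F) := prime_sum_X_pow_three 1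

instance isDomain_coordRing [CharP F 2] : IsDomain (CoordRing F) := by
  have : (Ideal.span {form F}).IsPrime :=
    (Ideal.span_singleton_prime prime_form.ne_zero).2 prime_form
  exact Ideal.Quotient.isDomain _

variable (F) in
/-- The class of the `i`-th variable in the homogeneous coordinate ring. -/
def coord (i : Fin 4) : CoordRing F := Ideal.Quotient.mkₐ F (Ideal.span {form F}) (X i)

theorem coord_mem_grading (i : Fin 4) : coord F i ∈ grading F 1 :=
  mk_mem_grading (isHomogeneous_X F i)

theorem sum_coord_pow_three : ∑ i, coord F i ^ 3 = 0 := by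
  have h : Ideal.Quotient.mkₐ F (Ideal.span {form F}) (form F) = 0 :=
    Ideal.Quotient.eq_zero_iff_mem.2 (Ideal.mem_span_singleton_self _)
  rw [form, map_sum] at h
  simp only [map_pow] at h
  exact h

theorem mkₐ_eq_aeval (p : MvPolynomial (Fin 4) F) :
    Ideal.Quotient.mkₐ F (Ideal.span {form F}) p = aeval (coord F) p := by
  refine DFunLike.congr_fun (?_ : Ideal.Quotient.mkₐ F (Ideal.span {form F}) = aeval (coord F)) p
  ext i
  simp [coord]

theorem aeval_coord_eq_zero_iff (p : MvPolynomial (Fin 4) F) :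
    aeval (coord F) p = 0 ↔ form F ∣ p := by
  rw [← mkₐ_eq_aeval, ← Ideal.mem_span_singleton]
  exact Ideal.Quotient.eq_zero_iff_mem

theorem exists_of_mem_grading {n : ℕ} {a : CoordRing F} (ha : a ∈ grading F n) :
    ∃ p : MvPolynomial (Fin 4) F, p.IsHomogeneous n ∧ aeval (coord F) p = a := by
  obtain ⟨p, hp, rfl⟩ := ha
  exact ⟨p, hp, (mkₐ_eq_aeval p).symm⟩

theorem aeval_coord_mem_grading {n : ℕ} {p : MvPolynomial (Fin 4) F} (hp : p.IsHomogeneous n) :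
    aeval (coord F) p ∈ grading F n := by
  rw [← mkₐ_eq_aeval]
  exact mk_mem_grading hp

theorem eq_zero_of_form_dvd {n : ℕ} (hn : n < 3) {p : MvPolynomial (Fin 4) F}
    (hp : p.IsHomogeneous n) (h : form F ∣ p) : p = 0 := by
  obtain ⟨q, rfl⟩ := h
  by_contra hne
  have hq : q ≠ 0 := right_ne_zero_of_mul hne
  have hf : form F ≠ 0 := left_ne_zero_of_mul hne
  have h1 := totalDegree_mul_of_isDomain hf hq
  rw [hp.totalDegree hne, (form_isHomogeneous F).totalDegree hf] at h1
  omega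

theorem linearForm_isHomogeneous (c : Fin 4 → F) :
    (∑ i, C (c i) * X i : MvPolynomial (Fin 4) F).IsHomogeneous 1 :=
  IsHomogeneous.sum _ _ _ fun i _ => isHomogeneous_C_mul_X _ i

theorem linearForm_eq_zero {c : Fin 4 → F}
    (h : (∑ i, C (c i) * X i : MvPolynomial (Fin 4) F) = 0) : c = 0 := by
  funext j
  have := congrArg (eval (Pi.single j (1 : F))) h
  simpa [Pi.single_apply] using this

theorem linearIndependent_coord : LinearIndependent F (coord F) := by
  rw [Fintype.linearIndependent_iff]
  intro c hc i
  have h : aeval (coord F) (∑ i, C (c i) * X i : MvPolynomial (Fin 4) F) = 0 := by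
    simp only [map_sum, map_mul, aeval_C, aeval_X, ← Algebra.smul_def]
    exact hc
  exact congrFun (linearForm_eq_zero (eq_zero_of_form_dvd (by norm_num)
    (linearForm_isHomogeneous c) ((aeval_coord_eq_zero_iff _).1 h))) i

theorem coord_ne_zero (i : Fin 4) : coord F i ≠ 0 := linearIndependent_coord.ne_zero i

theorem exists_eq_sum_of_mem_grading_one {a : CoordRing F} (ha : a ∈ grading F 1) :
    ∃ c : Fin 4 → F, a = ∑ i, c i • coord F i := by
  obtain ⟨p, hp, rfl⟩ := exists_of_mem_grading ha
  have hp' : p ∈ homogeneousSubmodule (Fin 4) F 1 := hp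
  rw [homogeneousSubmodule_one_eq_span_X, Submodule.mem_span_range_iff_exists_fun] at hp'
  obtain ⟨c, rfl⟩ := hp'
  exact ⟨c, by simp⟩

/-- A cubic form that vanishes on the surface is a constant times the equation. -/
theorem exists_eq_C_mul_form [CharP F 2] {p : MvPolynomial (Fin 4) F} (hp : p.IsHomogeneous 3)
    (h : form F ∣ p) : ∃ c : F, p = C c * form F := by
  obtain ⟨q, rfl⟩ := h
  by_cases hq : q = 0
  · exact ⟨0, by simp [hq]⟩
  have hf : form F ≠ 0 := prime_form.ne_zero
  have h1 := totalDegree_mul_of_isDomain hf hq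
  rw [hp.totalDegree (mul_ne_zero hf hq), (form_isHomogeneous F).totalDegree hf] at h1
  have h2 : q.totalDegree = 0 := by omega
  exact ⟨q.coeff 0, by rw [← totalDegree_eq_zero_iff_eq_C.1 h2, mul_comm]⟩

/-- Restriction of polynomials to the plane `x₀ = 0`. -/
def planeRestrict : MvPolynomial (Fin 4) F →+* MvPolynomial (Fin 3) F :=
  Polynomial.constantCoeff.comp (finSuccEquiv F 3).toRingEquiv.toRingHom

theorem planeRestrict_apply (p : MvPolynomial (Fin 4) F) :
    planeRestrict p = (finSuccEquiv F 3 p).coeff 0 := rfl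

theorem planeRestrict_form : planeRestrict (form F) = ∑ i : Fin 3, X i ^ 3 := by
  have h0 : planeRestrict (X 0 : MvPolynomial (Fin 4) F) = 0 := by
    rw [planeRestrict_apply, finSuccEquiv_X_zero, Polynomial.coeff_X_zero]
  have hs : ∀ i : Fin 3, planeRestrict (X i.succ : MvPolynomial (Fin 4) F) = X i := fun i => by
    rw [planeRestrict_apply, finSuccEquiv_X_succ, Polynomial.coeff_C_zero]
  rw [form, map_sum, Fin.sum_univ_succ]
  simp only [map_pow, h0, hs]
  simp

theorem planeRestrict_surjective : Function.Surjective (planeRestrict (F := F)) := fun q =>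
  ⟨(finSuccEquiv F 3).symm (Polynomial.C q), by rw [planeRestrict_apply]; simp⟩

theorem X_zero_dvd_iff (p : MvPolynomial (Fin 4) F) : X 0 ∣ p ↔ planeRestrict p = 0 := by
  rw [planeRestrict_apply, ← Polynomial.X_dvd_iff, ← finSuccEquiv_X_zero]
  exact (map_dvd_iff (finSuccEquiv F 3)).symm

theorem coord_zero_dvd_iff (p : MvPolynomial (Fin 4) F) :
    coord F 0 ∣ aeval (coord F) p ↔ (∑ i : Fin 3, X i ^ 3) ∣ planeRestrict p := by
  rw [← planeRestrict_form]
  constructor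
  · rintro ⟨a, ha⟩
    obtain ⟨q, rfl⟩ := Ideal.Quotient.mkₐ_surjective F (Ideal.span {form F}) a
    rw [mkₐ_eq_aeval] at ha
    have h : aeval (coord F) (p - X 0 * q) = 0 := by rw [map_sub, ha, map_mul, aeval_X, sub_self]
    obtain ⟨s, hs⟩ := (aeval_coord_eq_zero_iff _).1 h
    have h0 : planeRestrict (X 0 : MvPolynomial (Fin 4) F) = 0 :=
      (X_zero_dvd_iff _).1 dvd_rfl
    refine ⟨planeRestrict s, ?_⟩
    have := congrArg planeRestrict hs
    rwa [map_sub, map_mul, h0, zero_mul, sub_zero, map_mul] at this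
  · rintro ⟨s, hs⟩
    obtain ⟨s, rfl⟩ := planeRestrict_surjective s
    obtain ⟨q, hq⟩ := (X_zero_dvd_iff (p - form F * s)).2 (by rw [map_sub, map_mul, hs, sub_self])
    refine ⟨aeval (coord F) q, ?_⟩
    have h0 : aeval (coord F) (form F) = 0 := (aeval_coord_eq_zero_iff _).2 dvd_rfl
    have := congrArg (aeval (coord F)) hq
    rwa [map_sub, map_mul, h0, zero_mul, sub_zero, map_mul, aeval_X] at this

/-- The section of the surface by the plane `x₀ = 0` is an integral curve. -/
theorem prime_coord_zero [CharP F 2] : Prime (coord F 0) := by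
  have hp : Prime (∑ i : Fin 3, (X i : MvPolynomial (Fin 3) F) ^ 3) := prime_sum_X_pow_three 0
  refine ⟨coord_ne_zero 0, fun hu => ?_, fun a b hab => ?_⟩
  · have h := (coord_zero_dvd_iff (1 : MvPolynomial (Fin 4) F)).1 (by
      rw [map_one]; exact hu.dvd)
    rw [map_one] at h
    exact hp.not_isUnit (isUnit_of_dvd_one h)
  · obtain ⟨p, rfl⟩ := Ideal.Quotient.mkₐ_surjective F (Ideal.span {form F}) a
    obtain ⟨q, rfl⟩ := Ideal.Quotient.mkₐ_surjective F (Ideal.span {form F}) b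
    rw [mkₐ_eq_aeval, mkₐ_eq_aeval] at hab ⊢
    rw [← map_mul, coord_zero_dvd_iff, map_mul] at hab
    rw [coord_zero_dvd_iff, coord_zero_dvd_iff]
    exact hp.dvd_or_dvd hab

theorem not_coord_zero_dvd_coord_one [CharP F 2] : ¬ coord F 0 ∣ coord F 1 := by
  intro h
  have h' : coord F 0 ∣ aeval (coord F) (X 1 : MvPolynomial (Fin 4) F) := by rwa [aeval_X]
  rw [coord_zero_dvd_iff, planeRestrict_apply, ← Fin.succ_zero_eq_one, finSuccEquiv_X_succ,
    Polynomial.coeff_C_zero] at h'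
  have h1 := map_dvd (eval (![1, 1, 0] : Fin 3 → F)) h'
  simp [Fin.sum_univ_succ, one_add_one_eq_two, CharTwo.two_eq_zero] at h1

/-- A section of `𝒪(1)` regular on both charts `x₀ ≠ 0` and `x₁ ≠ 0` is a linear form. -/
theorem exists_linear_of_mul_pow_eq [CharP F 2] {m n : ℕ} {a b : CoordRing F}
    (ha : a ∈ grading F (m + 1)) (h : a * coord F 1 ^ n = b * coord F 0 ^ m) :
    ∃ l ∈ grading F 1, a = coord F 0 ^ m * l := by
  have hd : coord F 0 ^ m ∣ a := by
    have h1 : ¬ coord F 0 ∣ coord F 1 ^ n := fun h' =>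
      not_coord_zero_dvd_coord_one (prime_coord_zero.dvd_of_dvd_pow h')
    refine prime_coord_zero.pow_dvd_of_dvd_mul_right m h1 ?_
    rw [h]
    exact dvd_mul_left _ _
  obtain ⟨l, rfl⟩ := hd
  have hm : coord F 0 ^ m ∈ grading F m := by
    simpa using SetLike.pow_mem_graded m (coord_mem_grading (F := F) 0)
  refine ⟨DirectSum.decompose (grading F) l 1, SetLike.coe_mem _, ?_⟩
  rw [← DirectSum.coe_decompose_mul_add_of_left_mem (grading F) hm,
    DirectSum.decompose_of_mem_same _ ha]

/-- Substituting `yᵢ * t` for the variables multiplies a form of degree `n` by `tⁿ`. -/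
theorem aeval_mul_of_isHomogeneous {A : Type*} [CommRing A] [Algebra F A] {n : ℕ}
    {p : MvPolynomial (Fin 4) F} (hp : p.IsHomogeneous n) (y : Fin 4 → A) (t : A) :
    aeval (fun i => y i * t) p = aeval y p * t ^ n := by
  rw [aeval_def, aeval_def, eval₂_eq', eval₂_eq', Finset.sum_mul]
  refine Finset.sum_congr rfl fun d hd => ?_
  have hdeg : ∑ i, d i = n := by
    have := hp.degree_eq_sum_deg_support hd
    rw [this]
    exact (Finset.sum_subset (Finset.subset_univ _) fun i _ hi => by simpa using hi).symm
  rw [← hdeg, ← Finset.prod_pow_eq_pow_sum]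
  simp only [mul_pow, Finset.prod_mul_distrib]
  ring

end CoordinateRing

/-! ### Matrices that preserve the Fermat cubic form -/

section OrthogonalMatrices

open MvPolynomial

variable {F : Type*} [Field F]

theorem charP_two_of_card {k : ℕ} (hF : Nat.card F = 2 ^ (2 * k + 1)) : CharP F 2 := by
  have : Finite F := Nat.finite_of_card_ne_zero (by rw [hF]; positivity)
  have := Fintype.ofFinite F
  have h : ((2 ^ (2 * k + 1) : ℕ) : F) = 0 := by
    rw [← hF, Nat.card_eq_fintype_card]
    exact FiniteField.cast_card_eq_zero F
  refine CharTwo.of_one_ne_zero_of_two_eq_zero one_ne_zero ?_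
  push_cast at h
  exact pow_eq_zero_iff (by omega) |>.1 h

/-- Since `3` is prime to `2 ^ (2 * k + 1) - 1`, cubing is bijective on `F`. -/
theorem bijective_pow_three {k : ℕ} (hF : Nat.card F = 2 ^ (2 * k + 1)) :
    Function.Bijective fun x : F => x ^ 3 := by
  have : Finite F := Nat.finite_of_card_ne_zero (by rw [hF]; positivity)
  have := Fintype.ofFinite F
  have hsurj : Function.Surjective fun x : F => x ^ 3 := by
    intro x
    have hmod : ∀ k : ℕ, ∃ m, 2 ^ (2 * k + 1) = 3 * m + 2 := fun k => by
      induction k with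
      | zero => exact ⟨0, rfl⟩
      | succ k ih =>
        obtain ⟨m, hm⟩ := ih
        exact ⟨4 * m + 2, by rw [show 2 * (k + 1) + 1 = 2 * k + 1 + 2 by ring, pow_add, hm]; ring⟩
    obtain ⟨m, hm⟩ := hmod k
    have hx : x ^ (3 * m + 2) = x := by
      rw [← hm, ← hF, Nat.card_eq_fintype_card]
      exact FiniteField.pow_card x
    refine ⟨x ^ (2 * m + 1), ?_⟩
    -- With `q = 3 * m + 2` elements, `3 * (2 * m + 1) = q + (q - 1)`.
    calc (x ^ (2 * m + 1)) ^ 3 = x ^ (3 * m + 2) * x ^ (3 * m + 1) := by ring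
      _ = x * x ^ (3 * m + 1) := by rw [hx]
      _ = x ^ (3 * m + 2) := by ring
      _ = x := hx
  exact Finite.injective_iff_bijective.1 (Finite.injective_iff_surjective.2 hsurj)

/-- Polarization of the cubic form `∑ xᵢ³` in characteristic two: it is `H(x, x)` for the
Hermitian-like pairing `H(x, y) = ∑ xᵢ yᵢ²`, so a linear substitution multiplying it by `c`
multiplies `H` by `c`. -/
theorem transpose_mul_map_frobenius [CharP F 2] {A : Matrix (Fin 4) (Fin 4) F} {c : F}
    (h : ∑ i, (∑ j, C (A i j) * X j) ^ 3 = C c * form F) :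
    A.transpose * A.map (frobenius F 2) = c • (1 : Matrix (Fin 4) (Fin 4) F) := by
  have h3 : (3 : F) = 1 := by
    rw [show (3 : F) = 2 + 1 by norm_num, CharTwo.two_eq_zero, zero_add]
  ext j k
  rw [Matrix.mul_apply, Matrix.smul_apply, Matrix.one_apply]
  simp only [Matrix.transpose_apply, Matrix.map_apply, frobenius_def, smul_eq_mul]
  by_cases hjk : j = k
  · subst hjk
    have h1 := congrArg (eval (Pi.single j (1 : F))) h
    simp only [form, map_sum, map_pow, map_mul, eval_C, eval_X, Pi.single_apply, mul_ite, mul_one,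
      mul_zero, Finset.sum_ite_eq', Finset.mem_univ, if_true, ite_pow, one_pow,
      ne_eq, OfNat.ofNat_ne_zero, not_false_eq_true, zero_pow] at h1
    rw [if_pos rfl, mul_one, ← h1]
    exact Finset.sum_congr rfl fun i _ => by ring
  · -- Restrict to the line through the `j`-th and `k`-th coordinate points.
    let y : Fin 4 → Polynomial F := Pi.single j 1 + Pi.single k Polynomial.X
    have hy : ∀ i, ∑ l, Polynomial.C (A i l) * y l =
        Polynomial.C (A i j) + Polynomial.C (A i k) * Polynomial.X := by
      intro i
      simp [y, mul_add, Finset.sum_add_distrib, Pi.single_apply]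
    have hf : ∑ l, y l ^ 3 = 1 + Polynomial.X ^ 3 := by
      have : ∀ l, y l ^ 3 = (Pi.single j 1 : Fin 4 → Polynomial F) l +
          (Pi.single k (Polynomial.X ^ 3) : Fin 4 → Polynomial F) l := by
        intro l
        by_cases h1 : l = j
        · subst h1; simp [y, hjk]
        · by_cases h2 : l = k
          · subst h2; simp [y, h1]
          · simp [y, h1, h2]
      simp [this, Finset.sum_add_distrib, Pi.single_apply]
    have h1 := congrArg (aeval y) h
    simp only [form, map_sum, map_pow, map_mul, aeval_C, aeval_X, Polynomial.algebraMap_eq] at h1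
    simp only [hy, hf] at h1
    have h2 := congrArg (fun q => Polynomial.coeff q 2) h1
    have hcoeff : ∀ a b : F, ((Polynomial.C a + Polynomial.C b * Polynomial.X) ^ 3).coeff 2 =
        a * b ^ 2 := by
      intro a b
      have : (Polynomial.C a + Polynomial.C b * Polynomial.X) ^ 3 =
          Polynomial.C (b ^ 3) * Polynomial.X ^ 3 + Polynomial.C (3 * (a * b ^ 2)) * Polynomial.X ^ 2
          + Polynomial.C (3 * (a ^ 2 * b)) * Polynomial.X + Polynomial.C (a ^ 3) := by
        simp only [map_mul, map_pow, map_ofNat]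
        ring
      rw [this]
      simp only [Polynomial.coeff_add, Polynomial.coeff_C_mul, Polynomial.coeff_X_pow,
        Polynomial.coeff_X, Polynomial.coeff_C]
      simp [h3]
    simp only [Polynomial.finsetSum_coeff, hcoeff, Polynomial.coeff_C_mul, Polynomial.coeff_add,
      Polynomial.coeff_one, Polynomial.coeff_X_pow] at h2
    rw [h2, if_neg hjk]
    simp

/-- The orthogonal group of the standard bilinear form on `𝔽₂⁴`: besides the permutations of the
standard basis there are only their translates by the all-ones matrix. -/
theorem exists_perm_of_orthogonal {t : Matrix (Fin 4) (Fin 4) (ZMod 2)}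
    (h : t.transpose * t = 1) :
    ∃ (s : ZMod 2) (π : Equiv.Perm (Fin 4)), ∀ i j, t i j = (if j = π i then 1 else 0) + s := by
  have hdot : ∀ j k, ∑ i, t i j * t i k = if j = k then 1 else 0 := fun j k => by
    have := congrFun (congrFun h j) k
    rwa [Matrix.mul_apply, Matrix.one_apply] at this
  have hodd : ∀ v : Fin 4 → ZMod 2, ∑ i, v i * v i = 1 →
      ∃ (s : ZMod 2) (p : Fin 4), ∀ i, v i = (if i = p then 1 else 0) + s := by decide
  choose s p hsp using fun j => hodd (fun i => t i j) (by rw [hdot, if_pos rfl])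
  have hs : ∀ j k, j ≠ k → s j + s k = if p j = p k then 1 else 0 := by
    intro j k hjk
    have key : ∀ (a b : ZMod 2) (x y : Fin 4), (∑ i : Fin 4, ((if i = x then 1 else 0) + a) *
        ((if i = y then 1 else 0) + b) : ZMod 2) = 0 → a + b = if x = y then 1 else 0 := by decide
    refine key _ _ _ _ ?_
    simp only [← hsp]
    rw [hdot, if_neg hjk]
  have hsum : ∀ a b : ZMod 2, a + b = 0 ↔ a = b := by decide
  have hss : ∀ j k, s j = s k := by
    intro j k
    by_contra hne
    have hjk : j ≠ k := fun e => hne (by rw [e])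
    obtain ⟨l, hlj, hlk⟩ : ∃ l, l ≠ j ∧ l ≠ k := by
      have : ∀ j k : Fin 4, ∃ l, l ≠ j ∧ l ≠ k := by decide
      exact this j k
    have hpp : ∀ a b, s a ≠ s b → p a = p b := by
      intro a b hab
      by_contra hp
      have := hs a b (fun e => hab (by rw [e]))
      rw [if_neg hp] at this
      exact hab ((hsum _ _).1 this)
    have hps : ∀ a b, a ≠ b → s a = s b → p a ≠ p b := by
      intro a b hab he hp
      have := hs a b hab
      rw [if_pos hp, (hsum _ _).2 he] at this
      exact zero_ne_one this
    by_cases hl : s l = s j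
    · exact hps l j hlj hl ((hpp l k (by rwa [hl])).trans (hpp j k hne).symm)
    · have hl' : s l = s k := by
        revert hl hne
        generalize s l = a, s j = b, s k = c
        revert a b c
        decide
      exact hps l k hlk hl' ((hpp l j hl).trans (hpp j k hne))
  have hinj : Function.Injective p := by
    intro j k hp
    by_contra hjk
    have := hs j k hjk
    rw [if_pos hp, (hsum _ _).2 (hss j k)] at this
    exact zero_ne_one this
  let e : Equiv.Perm (Fin 4) := Equiv.ofBijective p (Finite.injective_iff_bijective.1 hinj)
  refine ⟨s 0, e.symm, fun i j => ?_⟩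
  rw [hsp, hss j 0]
  congr 1
  have : i = p j ↔ j = e.symm i := by
    rw [Equiv.eq_symm_apply]
    exact eq_comm
  simp only [this]

/-- A linear substitution that multiplies the cubic form by a constant is, up to a scalar, one of
the obvious ones. After division by a cube root of the constant, the entries satisfy `b⁴ = b`, so
that they are `0` or `1`, because `1` is the only cube root of unity in `F`. -/
theorem matrix_eq_smul_perm {k : ℕ} (hF : Nat.card F = 2 ^ (2 * k + 1)) [CharP F 2]
    {A : Matrix (Fin 4) (Fin 4) F} {c : F} (hA : IsUnit A)
    (h : ∑ i, (∑ j, C (A i j) * X j) ^ 3 = C c * form F) :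
    ∃ (d : F) (s : ZMod 2) (π : Equiv.Perm (Fin 4)),
      d ≠ 0 ∧ ∀ i j, A i j = d * ((if j = π i then 1 else 0) + ZMod.cast s) := by
  have hrel := transpose_mul_map_frobenius h
  have hc : c ≠ 0 := by
    rintro rfl
    rw [zero_smul] at hrel
    have h0 : A.map (frobenius F 2) = 0 := by
      have hu : IsUnit A.transpose := (Matrix.isUnit_transpose A).2 hA
      exact hu.mul_right_eq_zero.1 hrel
    have hA0 : A = 0 := by
      ext i j
      have := congrFun (congrFun h0 i) j
      simpa [frobenius_def] using this
    exact hA.ne_zero hA0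
  obtain ⟨d, hd⟩ := (bijective_pow_three hF).2 c
  have hd : d ^ 3 = c := hd
  have hd0 : d ≠ 0 := by
    rintro rfl
    exact hc (by rw [← hd]; simp)
  set B : Matrix (Fin 4) (Fin 4) F := d⁻¹ • A with hB
  have hB2 : B.map (frobenius F 2) = (d⁻¹) ^ 2 • A.map (frobenius F 2) := by
    ext i j
    simp [hB, frobenius_def, mul_pow]
  have hBB : B.transpose * B.map (frobenius F 2) = 1 := by
    rw [hB2, hB, Matrix.transpose_smul, Matrix.smul_mul, Matrix.mul_smul, hrel, smul_smul, smul_smul,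
      ← hd]
    rw [show d⁻¹ * d⁻¹ ^ 2 * d ^ 3 = 1 by field_simp, one_smul]
  -- `B⁽²⁾` is inverse to the transpose of `B`; iterating, `B⁽⁴⁾ = B`.
  have h4 : (B.map (frobenius F 2)).map (frobenius F 2) = B := by
    have h1 : B.map (frobenius F 2) * B.transpose = 1 := mul_eq_one_comm.1 hBB
    have h2 := congrArg (fun M : Matrix (Fin 4) (Fin 4) F => M.map (frobenius F 2)) h1
    simp only [Matrix.map_mul, Matrix.transpose_map] at h2
    rw [Matrix.map_one _ (map_zero _) (map_one _), ← Matrix.transpose_map] at h2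
    have h3 : (B.map (frobenius F 2)).transpose * B = 1 := by
      have := congrArg Matrix.transpose hBB
      rwa [Matrix.transpose_mul, Matrix.transpose_transpose, Matrix.transpose_one] at this
    calc _ = (B.map (frobenius F 2)).map (frobenius F 2) *
        ((B.map (frobenius F 2)).transpose * B) := by rw [h3, mul_one]
      _ = B := by rw [← mul_assoc, ← Matrix.transpose_map, h2, one_mul]
  have h01 : ∀ i j, B i j = 0 ∨ B i j = 1 := by
    intro i j
    have h5 := congrFun (congrFun h4 i) j
    simp only [Matrix.map_apply, frobenius_def] at h5
    by_cases hb : B i j = 0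
    · exact Or.inl hb
    · right
      refine (bijective_pow_three hF).1 ?_
      have : B i j * B i j ^ 3 = B i j * 1 := by
        rw [mul_one]
        calc B i j * B i j ^ 3 = (B i j ^ 2) ^ 2 := by ring
          _ = B i j := h5
      simpa using mul_left_cancel₀ hb this
  let ι : ZMod 2 →+* F := ZMod.castHom dvd_rfl F
  have hex : ∀ i j, ∃ x : ZMod 2, ι x = B i j := fun i j => by
    rcases h01 i j with h | h
    · exact ⟨0, by rw [map_zero, h]⟩
    · exact ⟨1, by rw [map_one, h]⟩
  choose t ht using hex
  have hsq : ∀ x : ZMod 2, x ^ 2 = x := by decide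
  have hort : (Matrix.of t).transpose * Matrix.of t = 1 := by
    have hmap : (Matrix.of t).map ι = B := by ext i j; exact ht i j
    have hfr : B.map (frobenius F 2) = B := by
      ext i j
      rw [Matrix.map_apply, ← ht, frobenius_def, ← map_pow, hsq]
    have hinj : Function.Injective fun M : Matrix (Fin 4) (Fin 4) (ZMod 2) => M.map ι :=
      Matrix.map_injective ι.injective
    refine hinj ?_
    simp only [Matrix.map_mul]
    rw [Matrix.transpose_map, hmap, Matrix.map_one _ (map_zero _) (map_one _)]
    rwa [hfr] at hBB
  obtain ⟨s, π, hsπ⟩ := exists_perm_of_orthogonal hort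
  refine ⟨d, s, π, hd0, fun i j => ?_⟩
  have hBij : B i j = (if j = π i then 1 else 0) + ι s := by
    rw [← ht]
    have := hsπ i j
    rw [Matrix.of_apply] at this
    rw [this, map_add]
    split_ifs <;> simp
  have : A i j = d * B i j := by
    rw [hB, Matrix.smul_apply, smul_eq_mul, mul_inv_cancel_left₀ hd0]
  rw [this, hBij]
  rfl

end OrthogonalMatrices

/-! ### The function field and its affine coordinates -/

section FunctionField

open MvPolynomial

variable {F : Type*} [Field F]

theorem exists_homogenization {R : Type*} [CommRing R] (j : Fin 4) (p : MvPolynomial (Fin 4) R) :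
    ∃ (n : ℕ) (q : MvPolynomial (Fin 4) R), q.IsHomogeneous n ∧
      ∀ (A : Type _) [CommRing A] [Algebra R A] (y : Fin 4 → A), y j = 1 →
        aeval y q = aeval y p := by
  refine ⟨p.totalDegree, ∑ k ∈ Finset.range (p.totalDegree + 1),
    X j ^ (p.totalDegree - k) * homogeneousComponent k p, ?_, ?_⟩
  · refine IsHomogeneous.sum _ _ _ fun k hk => ?_
    have h := (isHomogeneous_X_pow (R := R) j (p.totalDegree - k)).mul
      (homogeneousComponent_isHomogeneous k p)
    rwa [Nat.sub_add_cancel (Nat.lt_succ_iff.1 (Finset.mem_range.1 hk))] at h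
  · intro A _ _ y hy
    conv_rhs => rw [← sum_homogeneousComponent p]
    simp [hy]

variable (F) in
/-- The field of fractions of the homogeneous coordinate ring; the function field of the surface
consists of its elements of degree zero. -/
def FracRing [CharP F 2] : Type _ := FractionRing (CoordRing F)

variable [CharP F 2]

instance : Field (FracRing F) := inferInstanceAs (Field (FractionRing (CoordRing F)))

instance : Algebra (CoordRing F) (FracRing F) :=
  inferInstanceAs (Algebra (CoordRing F) (FractionRing (CoordRing F)))

instance : Algebra F (FracRing F) := inferInstanceAs (Algebra F (FractionRing (CoordRing F)))

instance : IsScalarTower F (CoordRing F) (FracRing F) :=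
  inferInstanceAs (IsScalarTower F (CoordRing F) (FractionRing (CoordRing F)))

instance : IsFractionRing (CoordRing F) (FracRing F) :=
  inferInstanceAs (IsFractionRing (CoordRing F) (FractionRing (CoordRing F)))

variable (F) in
/-- The `i`-th homogeneous coordinate as an element of the fraction field. -/
def fracCoord (i : Fin 4) : FracRing F := algebraMap (CoordRing F) (FracRing F) (coord F i)

theorem fracCoord_ne_zero (i : Fin 4) : fracCoord F i ≠ 0 :=
  (map_ne_zero_iff _ (IsFractionRing.injective (CoordRing F) (FracRing F))).2 (coord_ne_zero i)

theorem aeval_fracCoord (p : MvPolynomial (Fin 4) F) :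
    aeval (fracCoord F) p = algebraMap (CoordRing F) (FracRing F) (aeval (coord F) p) := by
  have h := map_aeval (coord F) (algebraMap (CoordRing F) (FracRing F)) p
  rw [h, aeval_def]
  rfl

theorem aeval_fracCoord_eq_zero_iff (p : MvPolynomial (Fin 4) F) :
    aeval (fracCoord F) p = 0 ↔ form F ∣ p := by
  rw [aeval_fracCoord, map_eq_zero_iff _ (IsFractionRing.injective (CoordRing F) (FracRing F)),
    aeval_coord_eq_zero_iff]

/-- Affine coordinates `r i = xᵢ / x₃` on a field `K` that make it the function field of the
Fermat cubic surface. The embedding `ν` of `K` in the fraction field of the homogeneous coordinate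
ring turns relations between the `r i` into relations between the homogeneous coordinates. -/
structure AffineCoords (K : Type*) [Field K] [Algebra F K] where
  /-- The embedding of the function field in the field of homogeneous fractions. -/
  ν : K →ₐ[F] FracRing F
  /-- The affine coordinates. -/
  r : Fin 4 → K
  ν_r : ∀ i, ν (r i) = fracCoord F i / fracCoord F 3
  exists_fraction : ∀ c, ∃ p q : MvPolynomial (Fin 4) F, aeval r q ≠ 0 ∧ c * aeval r q = aeval r p

namespace AffineCoords

variable {K : Type*} [Field K] [Algebra F K] (M : AffineCoords (F := F) K)

theorem ν_injective : Function.Injective M.ν := M.ν.toRingHom.injective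

theorem r_three : M.r 3 = 1 := M.ν_injective (by
  rw [M.ν_r, map_one, div_self (fracCoord_ne_zero 3)])

theorem r_ne_zero (i : Fin 4) : M.r i ≠ 0 := fun h => by
  have h' := M.ν_r i
  rw [h, map_zero] at h'
  exact div_ne_zero (fracCoord_ne_zero i) (fracCoord_ne_zero 3) h'.symm

theorem ν_aeval_div (j : Fin 4) {n : ℕ} {p : MvPolynomial (Fin 4) F} (hp : p.IsHomogeneous n) :
    M.ν (aeval (fun k => M.r k / M.r j) p) =
      algebraMap _ (FracRing F) (aeval (coord F) p) / fracCoord F j ^ n := by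
  have h : (fun k => M.ν (M.r k / M.r j)) = fun k => fracCoord F k * (fracCoord F j)⁻¹ := by
    funext k
    have := fracCoord_ne_zero (F := F) 3
    have := fracCoord_ne_zero (F := F) j
    rw [map_div₀, M.ν_r, M.ν_r]
    field_simp
  rw [← aeval_fracCoord, div_eq_mul_inv, ← inv_pow, ← aeval_mul_of_isHomogeneous hp, ← h]
  exact comp_aeval_apply _ M.ν p

theorem aeval_r_eq (p : MvPolynomial (Fin 4) F) :
    aeval M.r p = aeval (fun k => M.r k / M.r 3) p := by
  simp [M.r_three]

theorem aeval_r_eq_zero_iff {n : ℕ} {p : MvPolynomial (Fin 4) F} (hp : p.IsHomogeneous n) :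
    aeval M.r p = 0 ↔ form F ∣ p := by
  rw [aeval_r_eq, ← map_eq_zero_iff M.ν M.ν_injective, M.ν_aeval_div 3 hp, div_eq_zero_iff,
    or_iff_left (pow_ne_zero _ (fracCoord_ne_zero 3)), ← aeval_fracCoord,
    aeval_fracCoord_eq_zero_iff]

theorem sum_r_pow_three : ∑ i, M.r i ^ 3 = 0 := by
  have h := (M.aeval_r_eq_zero_iff (form_isHomogeneous F)).2 dvd_rfl
  simpa [form] using h

theorem linearIndependent_r : LinearIndependent F M.r := by
  rw [Fintype.linearIndependent_iff]
  intro c hc i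
  have h : aeval M.r (∑ i, C (c i) * X i : MvPolynomial (Fin 4) F) = 0 := by
    simp only [map_sum, map_mul, aeval_C, aeval_X, ← Algebra.smul_def]
    exact hc
  exact congrFun (linearForm_eq_zero (eq_zero_of_form_dvd (by norm_num)
    (linearForm_isHomogeneous c) ((M.aeval_r_eq_zero_iff (linearForm_isHomogeneous c)).1 h))) i

/-- The coordinate ring `F[x₀/xⱼ, …, x₃/xⱼ]` of the chart `xⱼ ≠ 0`, inside the function field. -/
def chart (j : Fin 4) : Subalgebra F K :=
  (aeval fun k => M.r k / M.r j : MvPolynomial (Fin 4) F →ₐ[F] K).range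

theorem div_mem_chart (j k : Fin 4) : M.r k / M.r j ∈ M.chart j := ⟨X k, by simp⟩

theorem exists_of_mem_chart {j : Fin 4} {c : K} (hc : c ∈ M.chart j) :
    ∃ n, ∃ a ∈ grading F n, M.ν c = algebraMap _ (FracRing F) a / fracCoord F j ^ n := by
  obtain ⟨p, rfl⟩ := hc
  obtain ⟨n, q, hq, hqp⟩ := exists_homogenization j p
  refine ⟨n, aeval (coord F) q, aeval_coord_mem_grading hq, ?_⟩
  rw [← M.ν_aeval_div j hq, hqp K _ (div_self (M.r_ne_zero j))]
  rfl

/-- A function with at most a simple pole along the plane section at infinity, on both of the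
charts `x₀ ≠ 0` and `x₁ ≠ 0`, is the quotient of a linear form by `x₃`. -/
theorem exists_eq_sum_of_div_mem_chart {g : K} (h0 : g / M.r 0 ∈ M.chart 0)
    (h1 : g / M.r 1 ∈ M.chart 1) : ∃ c : Fin 4 → F, g = ∑ i, c i • M.r i := by
  obtain ⟨m, a, ha, hνa⟩ := M.exists_of_mem_chart h0
  obtain ⟨n, b, hb, hνb⟩ := M.exists_of_mem_chart h1
  set alg := algebraMap (CoordRing F) (FracRing F) with halg
  have hinj : Function.Injective alg := IsFractionRing.injective (CoordRing F) (FracRing F)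
  have hx := fracCoord_ne_zero (F := F)
  have h03 := hx 0
  have h13 := hx 1
  have h33 := hx 3
  rw [map_div₀, M.ν_r, div_eq_iff (div_ne_zero h03 h33)] at hνa
  rw [map_div₀, M.ν_r, div_eq_iff (div_ne_zero h13 h33)] at hνb
  have heq : (a * coord F 0) * coord F 1 ^ n = (b * coord F 1) * coord F 0 ^ m := by
    apply hinj
    have h := hνa.symm.trans hνb
    field_simp at h
    simp only [map_mul, map_pow]
    change alg a * fracCoord F 0 * fracCoord F 1 ^ n = alg b * fracCoord F 1 * fracCoord F 0 ^ m
    linear_combination h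
  obtain ⟨l, hl, hal⟩ := exists_linear_of_mul_pow_eq
    (SetLike.mul_mem_graded ha (coord_mem_grading 0)) heq
  obtain ⟨c, rfl⟩ := exists_eq_sum_of_mem_grading_one hl
  refine ⟨c, M.ν_injective ?_⟩
  have hal' : alg a * fracCoord F 0 = fracCoord F 0 ^ m * ∑ i, c i • fracCoord F i := by
    have hsmul : ∀ (c : F) (s : CoordRing F), alg (c • s) = c • alg s :=
      map_smul (IsScalarTower.toAlgHom F (CoordRing F) (FracRing F))
    have := congrArg alg hal
    simp only [map_mul, map_pow, map_sum, hsmul] at this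
    exact this
  have hν : ∑ i, M.ν (c i • M.r i) = (∑ i, c i • fracCoord F i) / fracCoord F 3 := by
    rw [Finset.sum_div]
    refine Finset.sum_congr rfl fun i _ => ?_
    rw [map_smul, M.ν_r, smul_div_assoc]
  rw [hνa, map_sum, hν]
  field_simp
  linear_combination hal'

end AffineCoords

end FunctionField

/-! ### Biderivations -/

section Biderivations

open MvPolynomial

/-- Poisson brackets without the Jacobi identity: alternating biderivations of a commutative
algebra, that is, sections of the second exterior power of the tangent sheaf. As they are used in
characteristic two only, antisymmetry is stated as symmetry. -/
structure IsBiderivation (F : Type*) {K : Type*} [CommRing F] [CommRing K] [Algebra F K]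
    (β : K → K → K) : Prop where
  add_left : ∀ a a' b, β (a + a') b = β a b + β a' b
  smul_left : ∀ (c : F) a b, β (c • a) b = c • β a b
  mul_left : ∀ a a' b, β (a * a') b = a * β a' b + a' * β a b
  self : ∀ a, β a a = 0
  symm : ∀ a b, β a b = β b a

variable {F : Type*} [Field F] {K : Type*} [Field K] [Algebra F K]

namespace IsBiderivation

variable {β : K → K → K} (hβ : IsBiderivation F β)

/-- A biderivation as a derivation in its first argument. -/
def left (b : K) : Derivation F K K :=
  Derivation.mk' { toFun := fun a => β a b
                   map_add' := fun a a' => hβ.add_left a a' b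
                   map_smul' := fun c a => hβ.smul_left c a b } fun a a' => hβ.mul_left a a' b

theorem left_apply (a b : K) : hβ.left b a = β a b := rfl

include hβ in
theorem smul (g : K) : IsBiderivation F fun a b => g * β a b where
  add_left a a' b := by rw [hβ.add_left, mul_add]
  smul_left c a b := by rw [hβ.smul_left, mul_smul_comm]
  mul_left a a' b := by rw [hβ.mul_left]; ring
  self a := by rw [hβ.self, mul_zero]
  symm a b := by rw [hβ.symm]

include hβ in
/-- Transport of a biderivation along an automorphism. -/
theorem conj (σ : K ≃ₐ[F] K) : IsBiderivation F fun a b => σ (β (σ.symm a) (σ.symm b)) where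
  add_left a a' b := by rw [map_add, hβ.add_left, map_add]
  smul_left c a b := by rw [map_smul, hβ.smul_left, map_smul]
  mul_left a a' b := by rw [map_mul, hβ.mul_left, map_add, map_mul, map_mul]; simp
  self a := by rw [hβ.self, map_zero]
  symm a b := by rw [hβ.symm]

include hβ in
/-- The bracket of two fractions with the same denominator. -/
theorem div_div [CharP K 2] (a b : K) {c : K} (hc : c ≠ 0) :
    β (a / c) (b / c) = (c * β a b + a * β c b + b * β a c) / c ^ 3 := by
  have h2 : (2 : K) = 0 := CharTwo.two_eq_zero
  have h1 : ∀ a d, β (a / c) d = (c * β a d + a * β c d) / c ^ 2 := by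
    intro a d
    have h := (hβ.left d).leibniz_div a c
    simp only [left_apply, smul_eq_mul] at h
    rw [h]
    field_simp
    linear_combination (-a * β c d) * h2
  rw [h1, hβ.symm a, hβ.symm c, h1, h1, hβ.self, hβ.symm b a, hβ.symm b c, hβ.symm c a]
  field_simp
  ring

end IsBiderivation

/-- Two derivations of a field over `F` that agree on field generators are equal. -/
theorem derivation_ext {r : Fin 4 → K}
    (hr : ∀ c, ∃ p q : MvPolynomial (Fin 4) F, aeval r q ≠ 0 ∧ c * aeval r q = aeval r p)
    {D D' : Derivation F K K} (h : ∀ i, D (r i) = D' (r i)) : D = D' := by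
  have hpoly : ∀ p : MvPolynomial (Fin 4) F, D (aeval r p) = D' (aeval r p) := by
    intro p
    induction p using MvPolynomial.induction_on with
    | C a => simp
    | add p q hp hq => simp [hp, hq]
    | mul_X p i hp => simp [hp, h]
  ext c
  obtain ⟨p, q, hq, hc⟩ := hr c
  have h1 := congrArg D hc
  have h2 := congrArg D' hc
  rw [D.leibniz, hpoly, hpoly] at h1
  rw [D'.leibniz] at h2
  simp only [smul_eq_mul] at h1 h2
  exact mul_left_cancel₀ hq (by linear_combination h1 - h2)

theorem IsBiderivation.ext {r : Fin 4 → K}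
    (hr : ∀ c, ∃ p q : MvPolynomial (Fin 4) F, aeval r q ≠ 0 ∧ c * aeval r q = aeval r p)
    {β β' : K → K → K} (hβ : IsBiderivation F β) (hβ' : IsBiderivation F β')
    (h : ∀ i j, β (r i) (r j) = β' (r i) (r j)) : β = β' := by
  have h1 : ∀ j a, β a (r j) = β' a (r j) := fun j a =>
    congrArg (fun D : Derivation F K K => D a)
      (derivation_ext hr (D := hβ.left (r j)) (D' := hβ'.left (r j)) fun i => h i j)
  funext a b
  exact congrArg (fun D : Derivation F K K => D a)
    (derivation_ext hr (D := hβ.left b) (D' := hβ'.left b) fun i => by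
      rw [hβ.left_apply, hβ'.left_apply, hβ.symm, hβ'.symm, h1])

/-- A bracket that is regular on the generators `y` is regular on the algebra they generate. -/
theorem IsBiderivation.mem_range_aeval {β : K → K → K} (hβ : IsBiderivation F β) {y : Fin 4 → K}
    (h : ∀ i j, β (y i) (y j) ∈ (aeval y : MvPolynomial (Fin 4) F →ₐ[F] K).range) {a b : K}
    (ha : a ∈ (aeval y : MvPolynomial (Fin 4) F →ₐ[F] K).range)
    (hb : b ∈ (aeval y : MvPolynomial (Fin 4) F →ₐ[F] K).range) :
    β a b ∈ (aeval y : MvPolynomial (Fin 4) F →ₐ[F] K).range := by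
  set A := (aeval y : MvPolynomial (Fin 4) F →ₐ[F] K).range with hA
  have key : ∀ D : Derivation F K K, (∀ i, D (y i) ∈ A) → ∀ a ∈ A, D a ∈ A := by
    rintro D hD _ ⟨p, rfl⟩
    change D (aeval y p) ∈ A
    induction p using MvPolynomial.induction_on with
    | C a => simp
    | add p q hp hq => rw [map_add, map_add]; exact add_mem hp hq
    | mul_X p i hp =>
      rw [map_mul, aeval_X, D.leibniz]
      exact add_mem (A.mul_mem ⟨p, rfl⟩ (hD i)) (A.mul_mem ⟨X i, by simp⟩ hp)
  exact key (hβ.left b) (fun i => by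
    rw [hβ.left_apply, hβ.symm]
    exact key (hβ.left (y i)) (fun j => h j i) b hb) a ha

/-- A bracket that is regular on an algebra `A` is regular on the localizations of `A`. -/
theorem IsBiderivation.mem_of_fractions {β : K → K → K} (hβ : IsBiderivation F β)
    {A O : Subring K} (hAO : A ≤ O)
    (hO : ∀ c ∈ O, ∃ a ∈ A, ∃ s ∈ A, s ≠ 0 ∧ s⁻¹ ∈ O ∧ c = a * s⁻¹)
    (h : ∀ a ∈ A, ∀ b ∈ A, β a b ∈ A) {a b : K} (ha : a ∈ O) (hb : b ∈ O) : β a b ∈ O := by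
  have key : ∀ D : Derivation F K K, (∀ a ∈ A, D a ∈ O) → ∀ a ∈ O, D a ∈ O := by
    intro D hD c hc
    obtain ⟨a, ha, s, hs, -, hsO, rfl⟩ := hO c hc
    rw [D.leibniz, D.leibniz_inv]
    exact O.add_mem (O.mul_mem (hAO ha) (O.mul_mem (O.neg_mem (O.pow_mem hsO 2)) (hD s hs)))
      (O.mul_mem hsO (hD a ha))
  exact key (hβ.left b) (fun a ha => by
    rw [hβ.left_apply, hβ.symm]
    exact key (hβ.left a) (fun b hb => hAO (h b hb a ha)) b hb) a ha

variable [CharP F 2]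

namespace AffineCoords

variable (M : AffineCoords (F := F) K)

/-- Vector fields on the function field: prescribed values on the coordinates extend to a
derivation as soon as they are tangent to the surface. -/
theorem exists_derivation (d : Fin 4 → K) (h3 : d 3 = 0) (hd : ∑ i, M.r i ^ 2 * d i = 0) :
    ∃ D : Derivation F K K, ∀ i, D (M.r i) = d i := by
  -- The derivation is the `ε`-part of a homomorphism from `K` to the dual numbers `K[ε]`.
  let y : Fin 4 → TrivSqZeroExt K K := fun i => TrivSqZeroExt.inl (M.r i) + TrivSqZeroExt.inr (d i)
  have hfst : ∀ p : MvPolynomial (Fin 4) F,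
      (aeval y p : TrivSqZeroExt K K).fst = aeval M.r p := by
    intro p
    have h := comp_aeval_apply y (TrivSqZeroExt.fstHom F K K) p
    simpa [y] using h
  have hy3 : y 3 = 1 := by simp [y, h3, M.r_three]
  have hform : aeval y (form F) = 0 := by
    have h3 : (3 : K) = 1 := by
      have : CharP K 2 := charP_of_injective_algebraMap (algebraMap F K).injective 2
      rw [show (3 : K) = 2 + 1 by norm_num, CharTwo.two_eq_zero, zero_add]
    have hcube : ∀ a b : K, (TrivSqZeroExt.inl a + TrivSqZeroExt.inr b : TrivSqZeroExt K K) ^ 3 =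
        TrivSqZeroExt.inl (a ^ 3) + TrivSqZeroExt.inr (a ^ 2 * b) := by
      intro a b
      ext
      · simp
      · simp only [pow_succ, pow_zero, one_mul, TrivSqZeroExt.snd_mul, TrivSqZeroExt.fst_mul,
          TrivSqZeroExt.fst_add, TrivSqZeroExt.snd_add, TrivSqZeroExt.fst_inl,
          TrivSqZeroExt.snd_inl, TrivSqZeroExt.fst_inr, TrivSqZeroExt.snd_inr, smul_eq_mul,
          MulOpposite.smul_eq_mul_unop, MulOpposite.unop_op]
        linear_combination (a ^ 2 * b) * h3
    have hsum : ∑ i, y i ^ 3 = TrivSqZeroExt.inl (∑ i, M.r i ^ 3) +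
        TrivSqZeroExt.inr (∑ i, M.r i ^ 2 * d i) := by
      simp only [y, hcube, Finset.sum_add_distrib, TrivSqZeroExt.inl_sum, TrivSqZeroExt.inr_sum]
    rw [form, map_sum]
    simp only [map_pow, aeval_X]
    rw [hsum, M.sum_r_pow_three, hd]
    simp
  let P := MvPolynomial (Fin 4) F
  let I : Ideal P := RingHom.ker (aeval M.r : P →ₐ[F] K)
  have hker : ∀ p ∈ I, (aeval y : P →ₐ[F] TrivSqZeroExt K K) p = 0 := by
    intro p hp
    obtain ⟨n, q, hq, hqp⟩ := exists_homogenization 3 p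
    rw [← hqp _ y hy3]
    have hq0 : aeval M.r q = 0 := by rw [hqp K M.r M.r_three]; exact hp
    obtain ⟨s, rfl⟩ := (M.aeval_r_eq_zero_iff hq).1 hq0
    rw [map_mul, hform, zero_mul]
  let ψ : P ⧸ I →ₐ[F] TrivSqZeroExt K K := Ideal.Quotient.liftₐ I (aeval y) hker
  let κ : P ⧸ I →ₐ[F] K := Ideal.kerLiftAlg (aeval M.r : P →ₐ[F] K)
  have hκ : Function.Injective κ := Ideal.kerLiftAlg_injective _
  let : Algebra (P ⧸ I) K := κ.toRingHom.toAlgebra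
  have : IsScalarTower F (P ⧸ I) K := IsScalarTower.of_algebraMap_eq fun c => (κ.commutes c).symm
  have hfaithful : FaithfulSMul (P ⧸ I) K := (faithfulSMul_iff_algebraMap_injective _ _).2 hκ
  have hfrac : IsFractionRing (P ⧸ I) K := IsFractionRing.of_field (P ⧸ I) K fun c => by
    obtain ⟨p, q, hq, hc⟩ := M.exists_fraction c
    exact ⟨Ideal.Quotient.mk I p, Ideal.Quotient.mk I q, eq_div_of_mul_eq hq hc⟩
  have hψκ : ∀ a, (ψ a).fst = κ a := by
    intro a
    obtain ⟨p, rfl⟩ := Ideal.Quotient.mk_surjective a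
    exact hfst p
  have hunit : ∀ a : nonZeroDivisors (P ⧸ I), IsUnit (ψ a) := by
    intro a
    rw [TrivSqZeroExt.isUnit_iff_isUnit_fst, hψκ]
    exact IsLocalization.map_units K a
  let Ψ : K →ₐ[F] TrivSqZeroExt K K :=
    IsLocalization.liftAlgHom (M := nonZeroDivisors (P ⧸ I)) (f := ψ) hunit
  have hΨ : ∀ a, Ψ (κ a) = ψ a := fun a => IsLocalization.lift_eq (S := K) hunit a
  have hΨfst : ∀ c, (Ψ c).fst = c := by
    intro c
    obtain ⟨p, q, hq, hc⟩ := M.exists_fraction c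
    have h1 : ∀ p : P, (Ψ (aeval M.r p)).fst = aeval M.r p := fun p =>
      (congrArg TrivSqZeroExt.fst (hΨ (Ideal.Quotient.mk I p))).trans (hfst p)
    have h2 := congrArg (fun c => (Ψ c).fst) hc
    simp only [map_mul, TrivSqZeroExt.fst_mul, h1] at h2
    exact mul_right_cancel₀ hq (h2.trans hc.symm)
  refine ⟨Derivation.mk' { toFun := fun c => (Ψ c).snd
                           map_add' := fun a b => by rw [map_add, TrivSqZeroExt.snd_add]
                           map_smul' := fun c a => by
                            rw [map_smul, TrivSqZeroExt.snd_smul]; rfl } fun a b => ?_, fun i => ?_⟩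
  · simp [hΨfst, mul_comm]
  · have h : Ψ (M.r i) = y i := by
      have h := hΨ (Ideal.Quotient.mk I (X i))
      have h1 : κ (Ideal.Quotient.mk I (X i)) = M.r i := aeval_X M.r i
      have h2 : ψ (Ideal.Quotient.mk I (X i)) = y i := aeval_X y i
      rwa [h1, h2] at h
    change (Ψ (M.r i)).snd = d i
    rw [h]
    simp [y]

end AffineCoords

end Biderivations

/-! ### The standard bivector field -/

section StandardBivector

open MvPolynomial

variable {F : Type*} [Field F] [CharP F 2] {K : Type*} [Field K] [Algebra F K]

namespace AffineCoords

variable (M : AffineCoords (F := F) K)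

theorem charP_two (_ : AffineCoords (F := F) K) : CharP K 2 :=
  charP_of_injective_algebraMap (algebraMap F K).injective 2

include M in
theorem two_eq_zero : (2 : K) = 0 := by
  have := M.charP_two
  exact CharTwo.two_eq_zero

theorem sum_r_pow_three' : M.r 0 ^ 3 + M.r 1 ^ 3 + M.r 2 ^ 3 = 1 := by
  have h := M.sum_r_pow_three
  rw [Fin.sum_univ_four, M.r_three] at h
  linear_combination h - M.two_eq_zero

/-- The rational bivector field `β` on the surface given in affine coordinates by the partial
derivatives of the equation. It trivializes the anticanonical sheaf away from the plane section
`x₃ = 0`, along which it vanishes to first order. -/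
structure IsStandard (β : K → K → K) : Prop extends IsBiderivation F β where
  apply_zero_one : β (M.r 0) (M.r 1) = M.r 2 ^ 2
  apply_one_two : β (M.r 1) (M.r 2) = M.r 0 ^ 2
  apply_two_zero : β (M.r 2) (M.r 0) = M.r 1 ^ 2

theorem exists_isStandard : ∃ β, M.IsStandard β := by
  have h2 := M.two_eq_zero
  -- The two derivations are the Hamiltonian vector fields of `r 2` and `r 1`.
  obtain ⟨D, hD⟩ := M.exists_derivation ![M.r 1 ^ 2, M.r 0 ^ 2, 0, 0] rfl (by
    simp only [Fin.sum_univ_four, Matrix.cons_val]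
    linear_combination (M.r 0 ^ 2 * M.r 1 ^ 2) * h2)
  obtain ⟨E, hE⟩ := M.exists_derivation ![M.r 2 ^ 2, 0, M.r 0 ^ 2, 0] rfl (by
    simp only [Fin.sum_univ_four, Matrix.cons_val]
    linear_combination (M.r 0 ^ 2 * M.r 2 ^ 2) * h2)
  have h0 := M.r_ne_zero 0
  refine ⟨fun a b => (D a * E b + D b * E a) / M.r 0 ^ 2, ⟨?_, ?_, ?_, ?_, ?_⟩, ?_, ?_, ?_⟩
  · intro a a' b
    simp only [map_add]
    ring
  · intro c a b
    rw [D.map_smul, E.map_smul]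
    simp only [Algebra.smul_def]
    ring
  · intro a a' b
    simp only [Derivation.leibniz, smul_eq_mul]
    ring
  · intro a
    rw [← two_mul, h2, zero_mul, zero_div]
  · intro a b
    rw [add_comm]
  · simp only [hD, hE, Matrix.cons_val]
    field_simp
    ring
  · simp only [hD, hE, Matrix.cons_val]
    field_simp
    ring
  · simp only [hD, hE, Matrix.cons_val]
    field_simp
    ring

theorem apply_three {β : K → K → K} (hβ : IsBiderivation F β) (b : K) : β (M.r 3) b = 0 := by
  rw [M.r_three]
  exact (hβ.left b).map_one_eq_zero

/-- In homogeneous coordinates the standard bivector field is given by the partial derivatives of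
the form `x₀³ + x₁³ + x₂³ + x₃³`, whichever chart is used. -/
theorem IsStandard.numerator {β : K → K → K} (hβ : M.IsStandard β) (j k l : Fin 4) :
    (M.r j * β (M.r k) (M.r l) + M.r k * β (M.r j) (M.r l) + M.r l * β (M.r k) (M.r j) = 0) ∨
      ∃ m, M.r j * β (M.r k) (M.r l) + M.r k * β (M.r j) (M.r l) + M.r l * β (M.r k) (M.r j) =
        M.r m ^ 2 := by
  have h2 := M.two_eq_zero
  have hb := hβ.toIsBiderivation
  have h10 : β (M.r 1) (M.r 0) = M.r 2 ^ 2 := by rw [hb.symm, hβ.apply_zero_one]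
  have h21 : β (M.r 2) (M.r 1) = M.r 0 ^ 2 := by rw [hb.symm, hβ.apply_one_two]
  have h02 : β (M.r 0) (M.r 2) = M.r 1 ^ 2 := by rw [hb.symm, hβ.apply_two_zero]
  have h3 : ∀ b, β (M.r 3) b = 0 := M.apply_three hb
  have h3' : ∀ b, β b (M.r 3) = 0 := fun b => by rw [hb.symm, h3]
  have hs := M.sum_r_pow_three'
  by_cases hjk : j = k
  · subst hjk
    left
    rw [hb.self]
    linear_combination (M.r j * β (M.r j) (M.r l)) * h2
  by_cases hjl : j = l
  · subst hjl
    left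
    rw [hb.self]
    linear_combination (M.r j * β (M.r k) (M.r j)) * h2
  by_cases hkl : k = l
  · subst hkl
    left
    rw [hb.self, hb.symm (M.r j)]
    linear_combination (M.r k * β (M.r k) (M.r j)) * h2
  right
  -- For distinct `j`, `k`, `l` the index `m` is the remaining one.
  fin_cases j <;> fin_cases k <;> fin_cases l <;>
    first
      | exact absurd rfl hjk
      | exact absurd rfl hjl
      | exact absurd rfl hkl
      | skip
  all_goals
    simp only [Fin.zero_eta, Fin.mk_one, Fin.reduceFinMk, h3, h3', hβ.apply_zero_one,
      hβ.apply_one_two, hβ.apply_two_zero, h10, h21, h02]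
    first
      | exact ⟨0, by rw [M.r_three]; ring1⟩
      | exact ⟨1, by rw [M.r_three]; ring1⟩
      | exact ⟨2, by rw [M.r_three]; ring1⟩
      | exact ⟨3, by rw [M.r_three]; linear_combination hs⟩

/-- On each of the four charts, every product of the standard bivector field with an affine
coordinate is regular. -/
theorem IsStandard.mem_chart {β : K → K → K} (hβ : M.IsStandard β) (i j : Fin 4) {a b : K}
    (ha : a ∈ M.chart j) (hb : b ∈ M.chart j) : M.r i * β a b ∈ M.chart j := by
  have := M.charP_two
  refine (hβ.toIsBiderivation.smul (M.r i)).mem_range_aeval (fun k l => ?_) ha hb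
  change _ ∈ M.chart j
  rw [hβ.div_div _ _ (M.r_ne_zero j)]
  rcases hβ.numerator M j k l with h | ⟨m, h⟩
  · rw [h]
    simp
  · rw [h]
    have : M.r i * (M.r m ^ 2 / M.r j ^ 3) = M.r i / M.r j * (M.r m / M.r j) ^ 2 := by
      have := M.r_ne_zero j
      field_simp
    rw [this]
    exact mul_mem (M.div_mem_chart j i) (pow_mem (M.div_mem_chart j m) 2)

/-- Every bivector field is a multiple of the standard one. -/
theorem IsStandard.exists_eq_smul {β γ : K → K → K} (hβ : M.IsStandard β)
    (hγ : IsBiderivation F γ) : ∃ g, γ = fun a b => g * β a b := by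
  have h2 := M.two_eq_zero
  have hs := M.sum_r_pow_three'
  have hb := hβ.toIsBiderivation
  -- The differential of the equation of the surface has bracket zero with everything.
  have hrel : ∀ b, M.r 0 ^ 2 * γ (M.r 0) b + M.r 1 ^ 2 * γ (M.r 1) b +
      M.r 2 ^ 2 * γ (M.r 2) b = 0 := by
    intro b
    have h : hγ.left b (M.r 0 ^ 3 + M.r 1 ^ 3 + M.r 2 ^ 3) = hγ.left b 1 := by rw [hs]
    rw [map_add, map_add, Derivation.leibniz_pow, Derivation.leibniz_pow, Derivation.leibniz_pow,
      Derivation.map_one_eq_zero] at h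
    simp only [hγ.left_apply, smul_eq_mul, nsmul_eq_mul] at h
    push_cast at h
    linear_combination h - (M.r 0 ^ 2 * γ (M.r 0) b + M.r 1 ^ 2 * γ (M.r 1) b +
      M.r 2 ^ 2 * γ (M.r 2) b) * h2
  have hr0 := hrel (M.r 0)
  have hr1 := hrel (M.r 1)
  have hr2 := hrel (M.r 2)
  rw [hγ.self, hγ.symm (M.r 1)] at hr0
  rw [hγ.self, hγ.symm (M.r 2)] at hr1
  rw [hγ.self, hγ.symm (M.r 0)] at hr2
  set P := γ (M.r 0) (M.r 1)
  set Q := γ (M.r 1) (M.r 2)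
  set R := γ (M.r 2) (M.r 0)
  set g := M.r 0 * Q + M.r 1 * R + M.r 2 * P with hg
  have hQ : Q = g * M.r 0 ^ 2 := by
    linear_combination (-Q) * hs - M.r 1 * hr2 - M.r 2 * hr1 +
      (M.r 1 ^ 3 * Q + M.r 2 ^ 3 * Q) * h2
  have hR : R = g * M.r 1 ^ 2 := by
    linear_combination (-R) * hs - M.r 0 * hr2 - M.r 2 * hr0 +
      (M.r 0 ^ 3 * R + M.r 2 ^ 3 * R) * h2
  have hP : P = g * M.r 2 ^ 2 := by
    linear_combination (-P) * hs - M.r 0 * hr1 - M.r 1 * hr0 +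
      (M.r 0 ^ 3 * P + M.r 1 ^ 3 * P) * h2
  refine ⟨g, hγ.ext M.exists_fraction (hb.smul g) fun i j => ?_⟩
  have hsymm : ∀ i j, γ (M.r i) (M.r j) = g * β (M.r i) (M.r j) →
      γ (M.r j) (M.r i) = g * β (M.r j) (M.r i) := fun i j h => by rw [hγ.symm, h, hb.symm]
  have hself : ∀ i, γ (M.r i) (M.r i) = g * β (M.r i) (M.r i) := fun i => by
    rw [hγ.self, hb.self, mul_zero]
  have h3 : ∀ j, γ (M.r 3) (M.r j) = g * β (M.r 3) (M.r j) := fun j => by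
    rw [M.apply_three hγ, M.apply_three hb, mul_zero]
  have h01 : γ (M.r 0) (M.r 1) = g * β (M.r 0) (M.r 1) := by rw [hβ.apply_zero_one, ← hP]
  have h12 : γ (M.r 1) (M.r 2) = g * β (M.r 1) (M.r 2) := by rw [hβ.apply_one_two, ← hQ]
  have h20 : γ (M.r 2) (M.r 0) = g * β (M.r 2) (M.r 0) := by rw [hβ.apply_two_zero, ← hR]
  fin_cases i <;> fin_cases j <;>
    first
      | exact hself _
      | exact h3 _
      | exact hsymm _ _ (h3 _)
      | exact h01
      | exact h12
      | exact h20
      | exact hsymm _ _ h01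
      | exact hsymm _ _ h12
      | exact hsymm _ _ h20

/-- A multiple of the standard bivector field that is regular on the charts is the product with a
linear form: anticanonical sections are sections of `𝒪(1)`. -/
theorem IsStandard.exists_eq_sum {β : K → K → K} (hβ : M.IsStandard β) {g : K}
    (hg : ∀ j, ∀ a ∈ M.chart j, ∀ b ∈ M.chart j, g * β a b ∈ M.chart j) :
    ∃ c : Fin 4 → F, g = ∑ i, c i • M.r i := by
  have h2 := M.two_eq_zero
  have := M.charP_two
  have hb := hβ.toIsBiderivation
  have hs := M.sum_r_pow_three'
  have h3 : ∀ b, β (M.r 3) b = 0 := M.apply_three hb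
  have h3' : ∀ b, β b (M.r 3) = 0 := fun b => by rw [hb.symm, h3]
  have hr3 := M.r_three
  have h10 : β (M.r 1) (M.r 0) = M.r 2 ^ 2 := by rw [hb.symm, hβ.apply_zero_one]
  have h21 : β (M.r 2) (M.r 1) = M.r 0 ^ 2 := by rw [hb.symm, hβ.apply_one_two]
  have h02 : β (M.r 0) (M.r 2) = M.r 1 ^ 2 := by rw [hb.symm, hβ.apply_two_zero]
  have hmem : ∀ j k l, g * β (M.r k / M.r j) (M.r l / M.r j) ∈ M.chart j := fun j k l =>
    hg j _ (M.div_mem_chart j k) _ (M.div_mem_chart j l)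
  -- On the chart `xⱼ ≠ 0` contract with the Euler relation between the other three coordinates.
  have key : ∀ j a b c,
      M.r a / M.r j * (g * β (M.r b / M.r j) (M.r c / M.r j)) +
      M.r b / M.r j * (g * β (M.r c / M.r j) (M.r a / M.r j)) +
      M.r c / M.r j * (g * β (M.r a / M.r j) (M.r b / M.r j)) ∈ M.chart j := fun j a b c =>
    add_mem (add_mem (mul_mem (M.div_mem_chart j a) (hmem j b c))
      (mul_mem (M.div_mem_chart j b) (hmem j c a))) (mul_mem (M.div_mem_chart j c) (hmem j a b))
  have h0 := M.r_ne_zero 0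
  have h1 := M.r_ne_zero 1
  refine M.exists_eq_sum_of_div_mem_chart ?_ ?_
  · convert key 0 1 2 3 using 1
    rw [hb.div_div _ _ h0, hb.div_div _ _ h0, hb.div_div _ _ h0]
    simp only [h3, h3', hβ.apply_zero_one, hβ.apply_one_two, hβ.apply_two_zero, h10, h02]
    rw [hr3]
    field_simp
    linear_combination (-g * (M.r 1 ^ 3 + M.r 2 ^ 3)) * h2
  · convert key 1 0 2 3 using 1
    rw [hb.div_div _ _ h1, hb.div_div _ _ h1, hb.div_div _ _ h1]
    simp only [h3, h3', hβ.apply_zero_one, hβ.apply_one_two, h10, h21, h02]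
    rw [hr3]
    field_simp
    linear_combination (-g * (M.r 0 ^ 3 + M.r 2 ^ 3)) * h2

end AffineCoords

end StandardBivector

/-! ### Automorphisms of the function field that permute the local rings -/

section Reconstruction

open MvPolynomial

/-- The linear substitution attached to `(s, π) ∈ ℤ/2 × 𝔖₄`: it permutes the coordinates by `π`
and, if `s = 1`, adds the sum of all coordinates to each of them. -/
def permShift {A : Type*} [CommRing A] (y : Fin 4 → A) (s : ZMod 2) (π : Equiv.Perm (Fin 4))
    (i : Fin 4) : A :=
  y (π i) + ZMod.cast s * ∑ j, y j

variable {F : Type*} [Field F] [CharP F 2] {K : Type*} [Field K] [Algebra F K]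

namespace AffineCoords

variable (M : AffineCoords (F := F) K)

/-- The properties of the family of local rings of the surface, as subrings of its function field,
that single out the regular bivector fields: each of them is a localization of the coordinate ring
of some chart, and a function is regular on a chart if it is regular at all points of the chart. -/
structure IsLocalRingFamily {ι : Type*} (O : ι → Subring K) : Prop where
  exists_chart : ∀ x, ∃ j, (M.chart j).toSubring ≤ O x ∧
    ∀ c ∈ O x, ∃ a ∈ (M.chart j).toSubring, ∃ s ∈ (M.chart j).toSubring,
      s ≠ 0 ∧ s⁻¹ ∈ O x ∧ c = a * s⁻¹
  mem_chart : ∀ j c, (∀ x, (M.chart j).toSubring ≤ O x → c ∈ O x) → c ∈ M.chart j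

variable {ι : Type*} {O : ι → Subring K} (hO : M.IsLocalRingFamily O)

include hO in
theorem IsStandard.mem_localRing {β : K → K → K} (hβ : M.IsStandard β) (i : Fin 4) (x : ι)
    {a b : K} (ha : a ∈ O x) (hb : b ∈ O x) : M.r i * β a b ∈ O x := by
  obtain ⟨j, hj, hfrac⟩ := hO.exists_chart x
  exact (hβ.toIsBiderivation.smul (M.r i)).mem_of_fractions hj hfrac
    (fun a ha b hb => hβ.mem_chart M i j ha hb) ha hb

include hO in
/-- The regular bivector fields on the surface are the products of the standard one with the
linear forms. -/
theorem IsStandard.exists_eq_sum_mul {β γ : K → K → K} (hβ : M.IsStandard β)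
    (hγ : IsBiderivation F γ) (hreg : ∀ x, ∀ a ∈ O x, ∀ b ∈ O x, γ a b ∈ O x) :
    ∃ c : Fin 4 → F, γ = fun a b => (∑ i, c i • M.r i) * β a b := by
  obtain ⟨g, rfl⟩ := hβ.exists_eq_smul M hγ
  obtain ⟨c, rfl⟩ := hβ.exists_eq_sum M (g := g) fun j a ha b hb =>
    hO.mem_chart j _ fun x hx => hreg x a (hx ha) b (hx hb)
  exact ⟨c, rfl⟩

include hO in
/-- An automorphism of the function field that permutes the local rings of the surface acts
linearly on the space of regular bivector fields, hence on the homogeneous coordinates. -/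
theorem exists_matrix (σ : K ≃ₐ[F] K) (hσ : ∀ x, ∃ y, ∀ c, σ c ∈ O x ↔ c ∈ O y) :
    ∃ A : Matrix (Fin 4) (Fin 4) F, (∑ j, A 3 j • M.r j ≠ 0) ∧
      ∀ i, σ (M.r i) * ∑ j, A 3 j • M.r j = ∑ j, A i j • M.r j := by
  obtain ⟨β, hβ⟩ := M.exists_isStandard
  have hex : ∀ i, ∃ c : Fin 4 → F,
      (fun a b => σ (M.r i * β (σ.symm a) (σ.symm b))) = fun a b => (∑ j, c j • M.r j) * β a b := by
    intro i
    refine hβ.exists_eq_sum_mul M hO ((hβ.toIsBiderivation.smul (M.r i)).conj σ) ?_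
    intro x a ha b hb
    obtain ⟨y, hy⟩ := hσ x
    have hsymm : ∀ a ∈ O x, σ.symm a ∈ O y := fun a ha => (hy _).1 (by simpa using ha)
    exact (hy _).2 (hβ.mem_localRing M hO i y (hsymm a ha) (hsymm b hb))
  choose A hA using hex
  have hA' : ∀ i a b, σ (M.r i * β a b) = (∑ j, A i j • M.r j) * β (σ a) (σ b) := fun i a b => by
    have := congrFun (congrFun (hA i) (σ a)) (σ b)
    simpa using this
  -- Evaluate on a pair of functions whose bracket is nonzero.
  have hb : ∀ i, σ (M.r i) * σ (M.r 0 ^ 2) = (∑ j, A i j • M.r j) * β (σ (M.r 1)) (σ (M.r 2)) :=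
    fun i => by rw [← hA', hβ.apply_one_two, map_mul]
  have h3 := hb 3
  rw [M.r_three, map_one, one_mul] at h3
  have hne : σ (M.r 0 ^ 2) ≠ 0 := (map_ne_zero σ).2 (pow_ne_zero 2 (M.r_ne_zero 0))
  rw [h3] at hne
  refine ⟨A, left_ne_zero_of_mul hne, fun i => ?_⟩
  refine mul_right_cancel₀ (right_ne_zero_of_mul hne) ?_
  rw [mul_assoc, ← h3]
  exact hb i

include hO in
/-- An automorphism of the function field that permutes the local rings is given by one of the
obvious linear substitutions: its matrix preserves the equation of the surface up to a constant. -/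
theorem exists_permShift {k : ℕ} (hF : Nat.card F = 2 ^ (2 * k + 1)) (σ : K ≃ₐ[F] K)
    (hσ : ∀ x, ∃ y, ∀ c, σ c ∈ O x ↔ c ∈ O y) :
    ∃ (s : ZMod 2) (π : Equiv.Perm (Fin 4)), permShift M.r s π 3 ≠ 0 ∧
      ∀ i, σ (M.r i) * permShift M.r s π 3 = permShift M.r s π i := by
  obtain ⟨A, hA3, hA⟩ := M.exists_matrix hO σ hσ
  set q := ∑ j, A 3 j • M.r j with hq
  have hunit : IsUnit A := by
    rw [← Matrix.linearIndependent_rows_iff_isUnit, Fintype.linearIndependent_iff]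
    intro c hc
    have h1 : ∑ i, c i • M.r i = 0 := by
      refine (map_eq_zero σ).1 (mul_right_cancel₀ hA3 ?_)
      rw [zero_mul, map_sum, Finset.sum_mul]
      have h2 : ∀ i, σ (c i • M.r i) * q = ∑ j, (c i * A i j) • M.r j := fun i => by
        rw [map_smul, smul_mul_assoc, hA, Finset.smul_sum]
        simp only [smul_smul]
      simp only [h2]
      rw [Finset.sum_comm]
      refine Finset.sum_eq_zero fun j _ => ?_
      rw [← Finset.sum_smul]
      have := congrFun hc j
      simp only [Finset.sum_apply, Pi.smul_apply, Matrix.row_apply, smul_eq_mul,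
        Pi.zero_apply] at this
      rw [this, zero_smul]
    exact Fintype.linearIndependent_iff.1 M.linearIndependent_r c h1
  have hhom : (∑ i, (∑ j, C (A i j) * X j) ^ 3 : MvPolynomial (Fin 4) F).IsHomogeneous 3 :=
    IsHomogeneous.sum _ _ _ fun i _ => by
      simpa using (linearForm_isHomogeneous (A i)).pow 3
  have hvanish : aeval M.r (∑ i, (∑ j, C (A i j) * X j) ^ 3 : MvPolynomial (Fin 4) F) = 0 := by
    simp only [map_sum, map_pow, map_mul, aeval_C, aeval_X, ← Algebra.smul_def, ← hA, mul_pow]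
    rw [← Finset.sum_mul]
    simp only [← map_pow]
    rw [← map_sum, M.sum_r_pow_three, map_zero, zero_mul]
  obtain ⟨c, hc⟩ := exists_eq_C_mul_form hhom ((M.aeval_r_eq_zero_iff hhom).1 hvanish)
  obtain ⟨d, s, π, hd, hAd⟩ := matrix_eq_smul_perm hF hunit hc
  have := M.charP_two
  have hlin : ∀ i, ∑ j, A i j • M.r j = algebraMap F K d * permShift M.r s π i := by
    intro i
    have hcast : algebraMap F K (ZMod.cast s) = ZMod.cast s :=
      DFunLike.congr_fun (RingHom.ext_zmod ((algebraMap F K).comp (ZMod.castHom dvd_rfl F))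
        (ZMod.castHom dvd_rfl K)) s
    simp only [hAd, Algebra.smul_def, map_mul, map_add, hcast, permShift, mul_add, add_mul,
      Finset.sum_add_distrib, Finset.mul_sum]
    congr 1
    · rw [Finset.sum_eq_single (π i)]
      · simp
      · intro j _ hj
        simp [hj]
      · simp
    · exact Finset.sum_congr rfl fun j _ => by ring
  have hd' : algebraMap F K d ≠ 0 := (map_ne_zero _).2 hd
  rw [hq, hlin] at hA3
  refine ⟨s, π, right_ne_zero_of_mul hA3, fun i => mul_left_cancel₀ hd' ?_⟩
  rw [← hlin i, ← hA i, hq, hlin]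
  ring

/-- The function field is generated by the affine coordinates. -/
theorem ringHom_ext {σ τ : K →+* K} (hσ : ∀ c : F, σ (algebraMap F K c) = algebraMap F K c)
    (hτ : ∀ c : F, τ (algebraMap F K c) = algebraMap F K c) (h : ∀ i, σ (M.r i) = τ (M.r i)) :
    σ = τ := by
  have hpoly : ∀ p : MvPolynomial (Fin 4) F, σ (aeval M.r p) = τ (aeval M.r p) := by
    intro p
    induction p using MvPolynomial.induction_on with
    | C a => simp [hσ, hτ]
    | add p q hp hq => simp [hp, hq]
    | mul_X p i hp => simp [hp, h]
  ext c
  obtain ⟨p, q, hq, hc⟩ := M.exists_fraction c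
  have h1 := congrArg σ hc
  have h2 := congrArg τ hc
  rw [map_mul, hpoly, hpoly] at h1
  rw [map_mul] at h2
  have hne : τ (aeval M.r q) ≠ 0 := (map_ne_zero τ).2 hq
  exact mul_right_cancel₀ hne (h1.trans h2.symm)

end AffineCoords

end Reconstruction

/-! ### Automorphisms of integral schemes and their function fields -/

section IntegralSchemes

universe u

section IntegralScheme

variable (X : Scheme.{u}) [IsIntegral X]

/-- The local ring of a point of an integral scheme, as a subring of the function field. -/
def localSubring (x : X) : Subring X.functionField :=
  (algebraMap (X.presheaf.stalk x) X.functionField).range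

/-- The functions regular on an open subset, as a subring of the function field. -/
def sectionSubring (U : X.Opens) [Nonempty U] : Subring X.functionField :=
  (X.germToFunctionField U).hom.range

theorem sectionSubring_le_localSubring (U : X.Opens) [Nonempty U] {x : X} (hx : x ∈ U) :
    sectionSubring X U ≤ localSubring X x := by
  rintro _ ⟨s, rfl⟩
  exact ⟨X.presheaf.germ U x hx s, Scheme.algebraMap_germ_eq_germToFunctionField X hx s⟩

theorem exists_fraction_of_mem_localSubring {U : X.Opens} [Nonempty U] (hU : IsAffineOpen U)
    {x : X} (hx : x ∈ U) {c : X.functionField} (hc : c ∈ localSubring X x) :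
    ∃ a ∈ sectionSubring X U, ∃ s ∈ sectionSubring X U,
      s ≠ 0 ∧ s⁻¹ ∈ localSubring X x ∧ c = a * s⁻¹ := by
  obtain ⟨t, rfl⟩ := hc
  have hloc := hU.isLocalization_stalk ⟨x, hx⟩
  let _ := TopCat.Presheaf.algebra_section_stalk X.presheaf (⟨x, hx⟩ : U)
  obtain ⟨⟨a, s⟩, has⟩ := IsLocalization.surj (hU.primeIdealOf ⟨x, hx⟩).asIdeal.primeCompl t
  have hs : IsUnit (X.presheaf.germ U x hx s.1) := IsLocalization.map_units _ s
  have has' : t * X.presheaf.germ U x hx s.1 = X.presheaf.germ U x hx a := has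
  have hsK := hs.map (algebraMap (X.presheaf.stalk x) X.functionField)
  have hmul := congrArg (algebraMap (X.presheaf.stalk x) X.functionField) has'
  rw [map_mul] at hmul
  refine ⟨_, ⟨a, rfl⟩, _, ⟨s.1, rfl⟩, ?_, ?_, ?_⟩
  · rw [← Scheme.algebraMap_germ_eq_germToFunctionField X hx]
    exact hsK.ne_zero
  · obtain ⟨v, hv⟩ := hs.exists_right_inv
    refine ⟨v, eq_inv_of_mul_eq_one_right ?_⟩
    rw [← Scheme.algebraMap_germ_eq_germToFunctionField X hx, ← map_mul, hv, map_one]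
  · rw [← Scheme.algebraMap_germ_eq_germToFunctionField X hx,
      ← Scheme.algebraMap_germ_eq_germToFunctionField X hx]
    exact (eq_mul_inv_iff_mul_eq₀ hsK.ne_zero).2 hmul

/-- A rational function that is regular at all points of an affine open subset is regular there:
its ideal of denominators is not contained in any maximal ideal. -/
theorem mem_sectionSubring {U : X.Opens} [Nonempty U] (hU : IsAffineOpen U) {c : X.functionField}
    (hc : ∀ x ∈ U, c ∈ localSubring X x) : c ∈ sectionSubring X U := by
  let I : Ideal Γ(X, U) :=
    { carrier := {d | X.germToFunctionField U d * c ∈ sectionSubring X U}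
      add_mem' := fun {a b} ha hb => by
        simp only [Set.mem_ofPred_eq, map_add, add_mul] at ha hb ⊢
        exact add_mem ha hb
      zero_mem' := by simp
      smul_mem' := fun a b hb => by
        simp only [Set.mem_ofPred_eq, smul_eq_mul, map_mul, mul_assoc] at hb ⊢
        exact mul_mem ⟨a, rfl⟩ hb }
  have hI : I = ⊤ := by
    by_contra hne
    obtain ⟨m, hm, hIm⟩ := Ideal.exists_le_maximal I hne
    let p : Spec Γ(X, U) := ⟨m, hm.isPrime⟩
    have hxU : hU.fromSpec p ∈ U := by
      have : hU.fromSpec p ∈ hU.fromSpec.opensRange := ⟨p, rfl⟩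
      rwa [hU.opensRange_fromSpec] at this
    obtain ⟨t, rfl⟩ := hc _ hxU
    have hloc := hU.isLocalization_stalk ⟨_, hxU⟩
    let _ := TopCat.Presheaf.algebra_section_stalk X.presheaf (⟨_, hxU⟩ : U)
    obtain ⟨⟨a, s⟩, has⟩ := IsLocalization.surj (hU.primeIdealOf ⟨_, hxU⟩).asIdeal.primeCompl t
    have hp : hU.primeIdealOf ⟨_, hxU⟩ = p :=
      hU.fromSpec.isOpenEmbedding.injective (hU.fromSpec_primeIdealOf ⟨_, hxU⟩)
    have has' : t * X.presheaf.germ U _ hxU s.1 = X.presheaf.germ U _ hxU a := has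
    have hmul := congrArg (algebraMap (X.presheaf.stalk (hU.fromSpec p)) X.functionField) has'
    rw [map_mul, Scheme.algebraMap_germ_eq_germToFunctionField,
      Scheme.algebraMap_germ_eq_germToFunctionField] at hmul
    have hsI : s.1 ∈ I := ⟨a, by rw [mul_comm] at hmul; exact hmul.symm⟩
    have hsm : s.1 ∉ m := fun h =>
      s.2 ((SetLike.ext_iff.1 (congrArg PrimeSpectrum.asIdeal hp) s.1).2 h)
    exact hsm (hIm hsI)
  have h1 : (1 : Γ(X, U)) ∈ I := by rw [hI]; trivial
  simpa [I] using h1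

end IntegralScheme

section FunctionFieldMap

variable {X : Scheme.{u}} [IsIntegral X] (φ : X ⟶ X) [IsIso φ]

/-- The action of an automorphism of an integral scheme on its function field. -/
def functionFieldMap : X.functionField ⟶ X.functionField :=
  X.presheaf.stalkSpecializes (specializes_of_eq (genericPoint_eq_of_isOpenImmersion φ)) ≫
    φ.stalkMap (genericPoint X)

theorem SpecMap_functionFieldMap_fromSpecStalk :
    Spec.map (functionFieldMap φ) ≫ X.fromSpecStalk (genericPoint X) =
      X.fromSpecStalk (genericPoint X) ≫ φ := by
  rw [functionFieldMap, Spec.map_comp, Category.assoc,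
    Scheme.SpecMap_stalkSpecializes_fromSpecStalk, Scheme.SpecMap_stalkMap_fromSpecStalk]

theorem functionFieldMap_germ (U : X.Opens) (hU : genericPoint X ∈ U)
    (hφU : genericPoint X ∈ φ ⁻¹ᵁ U) :
    X.presheaf.germ U _ hU ≫ functionFieldMap φ =
      φ.app U ≫ X.presheaf.germ (φ ⁻¹ᵁ U) _ hφU := by
  rw [functionFieldMap, TopCat.Presheaf.germ_stalkSpecializes_assoc, Scheme.Hom.germ_stalkMap]

theorem functionFieldMap_bijective : Function.Bijective (functionFieldMap φ).hom := by
  have h : IsIso (X.presheaf.stalkSpecializes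
      (specializes_of_eq (genericPoint_eq_of_isOpenImmersion φ))) :=
    (X.presheaf.stalkCongr (.of_eq (genericPoint_eq_of_isOpenImmersion φ).symm)).isIso_hom
  have : IsIso (functionFieldMap φ) := by
    rw [functionFieldMap]
    infer_instance
  exact ConcreteCategory.bijective_of_isIso (functionFieldMap φ)

/-- Automorphisms permute the local rings. -/
theorem functionFieldMap_mem_localSubring_iff (x : X) (c : X.functionField) :
    (functionFieldMap φ).hom c ∈ localSubring X x ↔ c ∈ localSubring X (φ x) := by
  have hgen : ∀ y : X, genericPoint X ⤳ y := fun y => (genericPoint_spec X).specializes trivial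
  have hcomm : X.presheaf.stalkSpecializes (hgen (φ x)) ≫ functionFieldMap φ =
      φ.stalkMap x ≫ X.presheaf.stalkSpecializes (hgen x) := by
    rw [functionFieldMap, ← Category.assoc, TopCat.Presheaf.stalkSpecializes_comp,
      Scheme.Hom.stalkSpecializes_stalkMap]
  have hcomm' : ∀ t, (functionFieldMap φ).hom (algebraMap (X.presheaf.stalk (φ x)) _ t) =
      algebraMap (X.presheaf.stalk x) X.functionField ((φ.stalkMap x).hom t) := fun t =>
    DFunLike.congr_fun (CommRingCat.hom_ext_iff.1 hcomm) t
  constructor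
  · rintro ⟨t, ht⟩
    obtain ⟨t, rfl⟩ := (ConcreteCategory.bijective_of_isIso (φ.stalkMap x)).2 t
    refine ⟨t, (functionFieldMap_bijective φ).1 ?_⟩
    rw [← ht]
    exact hcomm' t
  · rintro ⟨t, rfl⟩
    exact ⟨_, (hcomm' t).symm⟩

/-- An automorphism of a separated integral scheme is determined by its action on the function
field. -/
theorem eq_of_functionFieldMap_eq [X.IsSeparated] {φ ψ : X ⟶ X} [IsIso φ] [IsIso ψ]
    (h : functionFieldMap φ = functionFieldMap ψ) : φ = ψ := by
  have : IsDominant (X.fromSpecStalk (genericPoint X)) := by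
    refine ⟨?_⟩
    have h1 : genericPoint X ∈ Set.range (X.fromSpecStalk (genericPoint X)) :=
      ⟨_, Scheme.fromSpecStalk_closedPoint⟩
    have h2 : Dense ({genericPoint X} : Set X) := by
      rw [dense_iff_closure_eq]
      exact genericPoint_closure X
    exact h2.mono (Set.singleton_subset_iff.2 h1)
  refine ext_of_isDominant (X.fromSpecStalk (genericPoint X)) ?_
  rw [← SpecMap_functionFieldMap_fromSpecStalk, ← SpecMap_functionFieldMap_fromSpecStalk, h]

end FunctionFieldMap

end IntegralSchemes

/-! ### The surface as an integral scheme -/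

section Proj

universe u

open HomogeneousLocalization

variable {F : Type u} [Field F]

instance (x : Proj (grading F)) : x.asHomogeneousIdeal.toIdeal.IsPrime := x.isPrime

theorem exists_mem_basicOpen_coord (x : Proj (grading F)) :
    ∃ j, x ∈ Proj.basicOpen (grading F) (coord F j) := by
  have h := Proj.iSup_basicOpen_eq_top' (grading F) (coord F) (fun i => ⟨1, coord_mem_grading i⟩)
    (eq_top_iff.2 fun a _ => by
      obtain ⟨p, rfl⟩ := Ideal.Quotient.mkₐ_surjective F (Ideal.span {form F}) a
      rw [mkₐ_eq_aeval]
      induction p using MvPolynomial.induction_on with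
      | C c =>
        rw [MvPolynomial.aeval_C]
        exact Subalgebra.algebraMap_mem _ (algebraMap F (grading F 0) c)
      | add p q hp hq => rw [map_add]; exact add_mem (hp trivial) (hq trivial)
      | mul_X p i hp =>
        rw [map_mul, MvPolynomial.aeval_X]
        exact mul_mem (hp trivial) (Algebra.subset_adjoin ⟨i, rfl⟩))
  exact TopologicalSpace.Opens.mem_iSup.1 (by rw [h]; trivial)

variable [CharP F 2]

variable (F) in
/-- The zero ideal, as a point of the surface; it is the generic point. -/
def zeroPoint : Proj (grading F) where
  asHomogeneousIdeal := ⊥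
  isPrime := by
    rw [HomogeneousIdeal.toIdeal_bot]
    exact Ideal.isPrime_bot
  not_irrelevant_le h := coord_ne_zero (F := F) 0
    (h (HomogeneousIdeal.mem_irrelevant_of_mem (grading F) one_pos (coord_mem_grading 0)))

theorem closure_zeroPoint : closure {zeroPoint F} = (Set.univ : Set (Proj (grading F))) := by
  refine Set.eq_univ_of_forall fun x => ?_
  exact (ProjectiveSpectrum.le_iff_mem_closure (𝒜 := grading F) (zeroPoint F) x).1
    (bot_le : (⊥ : HomogeneousIdeal (grading F)) ≤ x.asHomogeneousIdeal)

instance : IsIntegral (Proj (grading F)) := by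
  have hirr : IrreducibleSpace (Proj (grading F)) := by
    rw [irreducibleSpace_def, Set.top_eq_univ, ← closure_zeroPoint]
    exact isIrreducible_singleton.closure
  have hred : ∀ x : Proj (grading F), _root_.IsReduced ((Proj (grading F)).presheaf.stalk x) := by
    intro x
    have h1 : Function.Injective (algebraMap (AtPrime (grading F) x.asHomogeneousIdeal.toIdeal)
        (Localization.AtPrime x.asHomogeneousIdeal.toIdeal)) := val_injective _
    have h2 : IsDomain (Localization.AtPrime x.asHomogeneousIdeal.toIdeal) :=
      IsLocalization.isDomain_localization x.asHomogeneousIdeal.toIdeal.primeCompl_le_nonZeroDivisors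
    have h3 : _root_.IsReduced (AtPrime (grading F) x.asHomogeneousIdeal.toIdeal) :=
      isReduced_of_injective _ h1
    exact isReduced_of_injective (Proj.stalkIso (grading F) x).hom.hom
      (ConcreteCategory.bijective_of_isIso (Proj.stalkIso (grading F) x).hom).1
  have := isReduced_of_isReduced_stalk (Proj (grading F))
  exact isIntegral_of_irreducibleSpace_of_isReduced _

theorem isUnit_algebraMap_of_notMem {I : Ideal (CoordRing F)} [I.IsPrime] (y : I.primeCompl) :
    IsUnit (algebraMap (CoordRing F) (FracRing F) y) :=
  isUnit_iff_ne_zero.2 fun h => y.2 (by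
    rw [(map_eq_zero_iff _ (IsFractionRing.injective (CoordRing F) (FracRing F))).1 h]
    exact zero_mem _)

/-- A germ at a point of the surface, as a fraction of homogeneous elements. -/
def stalkToFrac (x : Proj (grading F)) :
    (Proj (grading F)).presheaf.stalk x →+* FracRing F :=
  (IsLocalization.lift (M := x.asHomogeneousIdeal.toIdeal.primeCompl)
    (S := Localization.AtPrime x.asHomogeneousIdeal.toIdeal)
    (g := algebraMap (CoordRing F) (FracRing F)) isUnit_algebraMap_of_notMem).comp
    ((algebraMap (AtPrime (grading F) x.asHomogeneousIdeal.toIdeal)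
      (Localization.AtPrime x.asHomogeneousIdeal.toIdeal)).comp
        (Proj.stalkIso (grading F) x).hom.hom)

/-- The germ of the section `a / fⁿ` of `D₊(f)` is the fraction `a / fⁿ`. -/
theorem stalkToFrac_germ (x : Proj (grading F)) {f : CoordRing F} {d n : ℕ} (hf : f ∈ grading F d)
    (hx : x ∈ Proj.basicOpen (grading F) f) {a : CoordRing F} (ha : a ∈ grading F (n • d)) :
    stalkToFrac x ((Proj (grading F)).presheaf.germ _ x hx
      ((Proj.awayToSection (grading F) f).hom (Away.mk (grading F) hf n a ha))) =
    algebraMap _ (FracRing F) a / algebraMap _ (FracRing F) f ^ n := by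
  have h := ProjectiveSpectrum.Proj.awayToSection_germ (𝒜 := grading F) f x hx
  have h1 := DFunLike.congr_fun (CommRingCat.hom_ext_iff.1 h) (Away.mk (grading F) hf n a ha)
  have h2 : (Proj.stalkIso (grading F) x).hom.hom ((Proj (grading F)).presheaf.germ _ x hx
      ((Proj.awayToSection (grading F) f).hom (Away.mk (grading F) hf n a ha))) =
      mapId (grading F) (Submonoid.powers_le.mpr hx) (Away.mk (grading F) hf n a ha) := by
    refine (congrArg (Proj.stalkIso (grading F) x).hom.hom h1).trans ?_
    exact DFunLike.congr_fun (CommRingCat.hom_ext_iff.1 (Proj.stalkIso (grading F) x).inv_hom_id) _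
  rw [stalkToFrac, RingHom.comp_apply, RingHom.comp_apply, h2]
  have h3 : algebraMap (AtPrime (grading F) x.asHomogeneousIdeal.toIdeal)
      (Localization.AtPrime x.asHomogeneousIdeal.toIdeal)
      (mapId (grading F) (Submonoid.powers_le.mpr hx) (Away.mk (grading F) hf n a ha)) =
      IsLocalization.mk' _ a (⟨f ^ n, (x.asHomogeneousIdeal.toIdeal.primeCompl).pow_mem hx n⟩ :
        x.asHomogeneousIdeal.toIdeal.primeCompl) := by
    rw [← Localization.mk_eq_mk']
    rfl
  rw [h3]
  refine eq_div_of_mul_eq (pow_ne_zero _ fun h0 => hx ?_) ?_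
  · rw [(map_eq_zero_iff _ (IsFractionRing.injective (CoordRing F) (FracRing F))).1 h0]
    exact zero_mem _
  · rw [← map_pow, ← IsLocalization.lift_eq (M := x.asHomogeneousIdeal.toIdeal.primeCompl)
      (S := Localization.AtPrime x.asHomogeneousIdeal.toIdeal) isUnit_algebraMap_of_notMem,
      ← map_mul, IsLocalization.mk'_spec, IsLocalization.lift_eq]

end Proj

/-! ### Affine coordinates on the surface -/

section Charts

universe u

open HomogeneousLocalization

variable {F : Type u} [Field F] [CharP F 2]

theorem genericPoint_mem_basicOpen (j : Fin 4) :
    genericPoint (Proj (grading F)) ∈ Proj.basicOpen (grading F) (coord F j) := by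
  have h : zeroPoint F ∈ Proj.basicOpen (grading F) (coord F j) := fun h => coord_ne_zero j h
  exact ((genericPoint_spec (Proj (grading F))).mem_open_set_iff
    (Proj.basicOpen (grading F) (coord F j)).isOpen).2 ⟨_, trivial, h⟩

instance (j : Fin 4) : Nonempty (Proj.basicOpen (grading F) (coord F j)) :=
  ⟨⟨_, genericPoint_mem_basicOpen j⟩⟩

variable (F) in
/-- The function field of the Fermat cubic surface. -/
abbrev FunField : Type u := (Proj (grading F)).functionField

variable (F) in
/-- The homogeneous fractions with a power of `xⱼ` in the denominator, as rational functions. -/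
def awayToFunField (j : Fin 4) : Away (grading F) (coord F j) →+* FunField F :=
  (Proj.awayToSection (grading F) (coord F j) ≫
    (Proj (grading F)).presheaf.germ _ _ (genericPoint_mem_basicOpen j)).hom

/-- The inclusion of the generic point factors through each of the charts. -/
theorem SpecMap_awayToFunField (j : Fin 4) :
    Spec.map (CommRingCat.ofHom (awayToFunField F j)) ≫
      Proj.awayι (grading F) (coord F j) (coord_mem_grading j) one_pos =
    (Proj (grading F)).fromSpecStalk (genericPoint (Proj (grading F))) := by
  rw [awayToFunField, CommRingCat.ofHom_hom, Spec.map_comp,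
    ← Scheme.Opens.fromSpecStalkOfMem_toSpecΓ, Category.assoc, Category.assoc]
  rw [← Proj.basicOpenIsoSpec_inv_ι]
  have h2 : (Proj.basicOpen (grading F) (coord F j)).toSpecΓ ≫
      Spec.map (Proj.awayToSection (grading F) (coord F j)) =
      (Proj.basicOpenIsoSpec (grading F) (coord F j) (coord_mem_grading j) one_pos).hom := by
    rw [Proj.basicOpenIsoSpec_hom]
    rfl
  rw [reassoc_of% h2, Iso.hom_inv_id_assoc, Scheme.Opens.fromSpecStalkOfMem_ι]

variable (F) in
/-- The constants, as rational functions. -/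
def constHom : F →+* FunField F :=
  (awayToFunField F 3).comp
    ((fromZeroRingHom (grading F) _).comp (algebraMap F (grading F 0)))

instance : Algebra F (FunField F) := (constHom F).toAlgebra

variable (F) in
/-- The morphism from the Fermat cubic surface to the spectrum of the base field. -/
def structureMap : Proj (grading F) ⟶ Spec (CommRingCat.of F) := (fermatCubic F).hom

theorem SpecMap_constHom : Spec.map (CommRingCat.ofHom (constHom F)) =
    (Proj (grading F)).fromSpecStalk (genericPoint (Proj (grading F))) ≫
      structureMap F := by
  rw [← SpecMap_awayToFunField 3]
  change _ = _ ≫ Proj.toSpecZero (grading F) ≫ _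
  rw [Category.assoc, Proj.awayι_toSpecZero_assoc, ← Spec.map_comp, ← Spec.map_comp]
  rfl

/-- An automorphism over the base field fixes the constants in the function field. -/
theorem functionFieldMap_algebraMap (φ : Proj (grading F) ⟶ Proj (grading F)) [IsIso φ]
    (hφ : φ ≫ structureMap F = structureMap F) (c : F) :
    (functionFieldMap φ).hom (algebraMap F (FunField F) c) = algebraMap F (FunField F) c := by
  have h : CommRingCat.ofHom (constHom F) ≫ functionFieldMap φ =
      CommRingCat.ofHom (constHom F) := by
    apply Spec.map_injective
    rw [Spec.map_comp, SpecMap_constHom, reassoc_of% (SpecMap_functionFieldMap_fromSpecStalk φ), hφ]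
  exact DFunLike.congr_fun (CommRingCat.hom_ext_iff.1 h) c

theorem stalkToFrac_awayToFunField (j : Fin 4) {n : ℕ} {a : CoordRing F}
    (ha : a ∈ grading F (n • 1)) :
    stalkToFrac (genericPoint (Proj (grading F)))
      (awayToFunField F j (Away.mk (grading F) (coord_mem_grading j) n a ha)) =
    algebraMap _ (FracRing F) a / fracCoord F j ^ n :=
  stalkToFrac_germ _ (coord_mem_grading j) (genericPoint_mem_basicOpen j) ha

/-- A chart is affine with coordinate ring the homogeneous fractions. -/
theorem sectionSubring_basicOpen (j : Fin 4) :
    sectionSubring (Proj (grading F)) (Proj.basicOpen (grading F) (coord F j)) =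
      (awayToFunField F j).range := by
  ext c
  constructor
  · rintro ⟨s, rfl⟩
    have h := (Proj.basicOpenIsoAway (grading F) (coord F j) (coord_mem_grading j)
      one_pos).inv_hom_id
    rw [Proj.basicOpenIsoAway_hom] at h
    refine ⟨(Proj.basicOpenIsoAway (grading F) (coord F j) (coord_mem_grading j)
      one_pos).inv.hom s, ?_⟩
    exact congrArg ((Proj (grading F)).presheaf.germ _ _ (genericPoint_mem_basicOpen j)).hom
      (DFunLike.congr_fun (CommRingCat.hom_ext_iff.1 h) s)
  · rintro ⟨s, rfl⟩
    exact ⟨_, rfl⟩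

variable (F) in
/-- The embedding of the function field in the field of homogeneous fractions. -/
def funFieldToFrac : FunField F →ₐ[F] FracRing F where
  __ := stalkToFrac (genericPoint (Proj (grading F)))
  commutes' c := by
    have h0 : algebraMap F (CoordRing F) c ∈ grading F (0 • 1) :=
      (algebraMap F (grading F 0) c).2
    have h : fromZeroRingHom (grading F) (Submonoid.powers (coord F 3))
        (algebraMap F (grading F 0) c) =
        Away.mk (grading F) (coord_mem_grading 3) 0 (algebraMap F (CoordRing F) c) h0 := by
      refine val_injective _ ?_
      rw [Away.val_mk]
      change Localization.mk _ _ = Localization.mk _ _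
      congr 1
    refine (congrArg (fun z => stalkToFrac (genericPoint (Proj (grading F)))
      (awayToFunField F 3 z)) h).trans ?_
    refine (stalkToFrac_awayToFunField 3 h0).trans ?_
    rw [pow_zero, div_one, ← IsScalarTower.algebraMap_apply]

theorem funFieldToFrac_awayToFunField (j : Fin 4) {n : ℕ} {a : CoordRing F}
    (ha : a ∈ grading F (n • 1)) :
    funFieldToFrac F (awayToFunField F j (Away.mk (grading F) (coord_mem_grading j) n a ha)) =
    algebraMap _ (FracRing F) a / fracCoord F j ^ n :=
  stalkToFrac_awayToFunField j ha

theorem funFieldToFrac_injective : Function.Injective (funFieldToFrac F) :=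
  (funFieldToFrac F).toRingHom.injective

variable (F) in
/-- The rational function `xᵢ / xⱼ`. -/
def coordDiv (i j : Fin 4) : FunField F :=
  awayToFunField F j (Away.mk (grading F) (coord_mem_grading j) 1 (coord F i) (coord_mem_grading i))

theorem funFieldToFrac_coordDiv (i j : Fin 4) :
    funFieldToFrac F (coordDiv F i j) = fracCoord F i / fracCoord F j := by
  rw [coordDiv, funFieldToFrac_awayToFunField, pow_one, fracCoord, fracCoord]

theorem range_awayToFunField (j : Fin 4) : (awayToFunField F j).range =
    (MvPolynomial.aeval (fun i => coordDiv F i j) :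
      MvPolynomial (Fin 4) F →ₐ[F] FunField F).range.toSubring := by
  ext c
  constructor
  · rintro ⟨s, rfl⟩
    obtain ⟨n, a, ha, rfl⟩ := Away.mk_surjective (grading F) (coord_mem_grading j) s
    obtain ⟨p, hp, rfl⟩ := exists_of_mem_grading ha
    refine ⟨p, funFieldToFrac_injective ?_⟩
    rw [funFieldToFrac_awayToFunField, ← aeval_fracCoord, div_eq_mul_inv, ← inv_pow,
      ← aeval_mul_of_isHomogeneous (by simpa using hp)]
    refine (MvPolynomial.comp_aeval_apply _ (funFieldToFrac F) p).trans ?_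
    simp only [funFieldToFrac_coordDiv, div_eq_mul_inv]
  · rintro ⟨p, rfl⟩
    change MvPolynomial.aeval (fun i => coordDiv F i j) p ∈ _
    induction p using MvPolynomial.induction_on with
    | C c =>
      have h0 : algebraMap F (CoordRing F) c ∈ grading F (0 • 1) :=
        (algebraMap F (grading F 0) c).2
      refine ⟨Away.mk (grading F) (coord_mem_grading j) 0 _ h0, funFieldToFrac_injective ?_⟩
      rw [funFieldToFrac_awayToFunField, MvPolynomial.aeval_C, AlgHom.commutes, pow_zero, div_one,
        ← IsScalarTower.algebraMap_apply]
    | add p q hp hq => rw [map_add]; exact add_mem hp hq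
    | mul_X p i hp =>
      rw [map_mul, MvPolynomial.aeval_X]
      exact mul_mem hp ⟨_, rfl⟩

variable (F) in
/-- The affine coordinates `xᵢ / x₃` on the Fermat cubic surface. -/
def affineCoords : AffineCoords (F := F) (FunField F) where
  ν := funFieldToFrac F
  r i := coordDiv F i 3
  ν_r i := funFieldToFrac_coordDiv i 3
  exists_fraction c := by
    have hU := Proj.isAffineOpen_basicOpen (grading F) (coord F 3) (coord_mem_grading 3) one_pos
    have := functionField_isFractionRing_of_isAffineOpen (Proj (grading F)) _ hU
    obtain ⟨a, b, hb, rfl⟩ := IsFractionRing.div_surjective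
      (A := Γ(Proj (grading F), Proj.basicOpen (grading F) (coord F 3))) c
    have hmem : ∀ s, algebraMap Γ(Proj (grading F), Proj.basicOpen (grading F) (coord F 3))
        (FunField F) s ∈ (awayToFunField F 3).range := fun s => by
      rw [← sectionSubring_basicOpen]
      exact ⟨s, rfl⟩
    simp only [range_awayToFunField] at hmem
    obtain ⟨p, hp⟩ := hmem a
    obtain ⟨q, hq⟩ := hmem b
    have hb0 := IsFractionRing.to_map_ne_zero_of_mem_nonZeroDivisors (K := FunField F) hb
    refine ⟨p, q, ?_, ?_⟩
    · exact fun h => hb0 (hq.symm.trans h)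
    · refine (congrArg _ hq).trans ((div_mul_cancel₀ _ hb0).trans hp.symm)

theorem affineCoords_r_div (i j : Fin 4) :
    (affineCoords F).r i / (affineCoords F).r j = coordDiv F i j := by
  refine funFieldToFrac_injective ?_
  rw [map_div₀]
  change funFieldToFrac F (coordDiv F i 3) / funFieldToFrac F (coordDiv F j 3) = _
  rw [funFieldToFrac_coordDiv, funFieldToFrac_coordDiv, funFieldToFrac_coordDiv]
  exact div_div_div_cancel_right₀ (fracCoord_ne_zero 3) _ _

theorem chart_affineCoords (j : Fin 4) : ((affineCoords F).chart j).toSubring =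
    sectionSubring (Proj (grading F)) (Proj.basicOpen (grading F) (coord F j)) := by
  rw [sectionSubring_basicOpen, range_awayToFunField, AffineCoords.chart]
  simp only [affineCoords_r_div]

/-- The local rings of the points of the surface are determined by the four charts. -/
theorem isLocalRingFamily_localSubring :
    (affineCoords F).IsLocalRingFamily (localSubring (Proj (grading F))) where
  exists_chart x := by
    obtain ⟨j, hj⟩ := exists_mem_basicOpen_coord x
    refine ⟨j, ?_, ?_⟩
    · rw [chart_affineCoords]
      exact sectionSubring_le_localSubring _ _ hj
    · intro c hc
      rw [chart_affineCoords]
      exact exists_fraction_of_mem_localSubring _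
        (Proj.isAffineOpen_basicOpen (grading F) _ (coord_mem_grading j) one_pos) hj hc
  mem_chart j c hc := by
    have h := mem_sectionSubring (Proj (grading F))
      (Proj.isAffineOpen_basicOpen (grading F) _ (coord_mem_grading j) one_pos) (c := c)
      fun x hx => hc x (by
        rw [chart_affineCoords]
        exact sectionSubring_le_localSubring _ _ hx)
    rwa [← chart_affineCoords] at h

end Charts

/-! ### Linear substitutions as automorphisms of the surface -/

section Substitutions

universe u

open HomogeneousLocalization MvPolynomial

section PermShift

variable {A B : Type*} [CommRing A] [CommRing B]

theorem map_permShift {G : Type*} [FunLike G A B] [RingHomClass G A B] (f : G)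
    (y : Fin 4 → A) (s : ZMod 2) (π : Equiv.Perm (Fin 4)) (i : Fin 4) : f (permShift y s π i) = permShift (fun j => f (y j)) s π i := by
  simp only [permShift, map_add, map_mul, map_sum, ZMod.cast_eq_val, map_natCast]

theorem permShift_mul (y : Fin 4 → A) (t : A) (s : ZMod 2) (π : Equiv.Perm (Fin 4)) (i : Fin 4) :
    permShift (fun j => y j * t) s π i = permShift y s π i * t := by
  simp only [permShift, ← Finset.sum_mul]
  ring

variable [CharP A 2]

/-- The substitutions preserve the Fermat cubic form, as `∑ xᵢ² = (∑ xᵢ)²` in characteristic two. -/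
theorem sum_permShift_pow_three {y : Fin 4 → A} (hy : ∑ i, y i ^ 3 = 0) (s : ZMod 2)
    (π : Equiv.Perm (Fin 4)) : ∑ i, permShift y s π i ^ 3 = 0 := by
  simp only [permShift]
  rw [Equiv.sum_comp π fun i => (y i + ZMod.cast s * ∑ j, y j) ^ 3]
  have h2 : (2 : A) = 0 := CharTwo.two_eq_zero
  rw [Fin.sum_univ_four] at hy ⊢
  rw [Fin.sum_univ_four]
  have hs : (ZMod.cast s : A) = 0 ∨ (ZMod.cast s : A) = 1 := by
    fin_cases s
    · exact Or.inl ZMod.cast_zero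
    · exact Or.inr (ZMod.cast_one dvd_rfl)
  rcases hs with hs | hs <;> rw [hs]
  · simpa using hy
  · linear_combination hy + (3 * (y 0 + y 1 + y 2 + y 3) * (y 0 ^ 2 + y 1 ^ 2 + y 2 ^ 2 + y 3 ^ 2 +
      y 0 * y 1 + y 0 * y 2 + y 0 * y 3 + y 1 * y 2 + y 1 * y 3 + y 2 * y 3) +
      2 * (y 0 + y 1 + y 2 + y 3) ^ 3) * h2

theorem permShift_permShift (y : Fin 4 → A) (s t : ZMod 2) (π τ : Equiv.Perm (Fin 4)) (i : Fin 4) :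
    permShift (permShift y t τ) s π i = permShift y (t + s) (τ * π) i := by
  have h2 : (2 : A) = 0 := CharTwo.two_eq_zero
  have hsum : ∑ j, permShift y t τ j = ∑ j, y j := by
    simp only [permShift, Finset.sum_add_distrib, Equiv.sum_comp τ y, Finset.sum_const,
      Finset.card_univ, Fintype.card_fin, nsmul_eq_mul]
    push_cast
    linear_combination (2 * (ZMod.cast t * ∑ j, y j)) * h2
  rw [permShift, hsum, permShift, permShift, ZMod.cast_add dvd_rfl, Equiv.Perm.mul_apply]
  ring

end PermShift

variable {F : Type u} [Field F]

theorem coordRing_algHom_ext {f g : CoordRing F →ₐ[F] CoordRing F}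
    (h : ∀ i, f (coord F i) = g (coord F i)) : f = g := by
  refine AlgHom.ext fun a => ?_
  obtain ⟨p, rfl⟩ := Ideal.Quotient.mkₐ_surjective F (Ideal.span {form F}) a
  rw [mkₐ_eq_aeval, comp_aeval_apply, comp_aeval_apply]
  simp only [h]

variable [CharP F 2]

instance : CharP (CoordRing F) 2 :=
  charP_of_injective_algebraMap (algebraMap F (CoordRing F)).injective 2

/-- The group `ℤ/2 × 𝔖₄` of the obvious symmetries of the surface: permutations of the coordinates,
and addition of the sum of the coordinates to each of them. -/
abbrev SymGroup : Type := Multiplicative (ZMod 2) × Equiv.Perm (Fin 4)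

variable (F) in
/-- The automorphism of the homogeneous coordinate ring given by a linear substitution. -/
def substHom (g : SymGroup) : CoordRing F →ₐ[F] CoordRing F :=
  Ideal.Quotient.liftₐ (Ideal.span {form F}) (aeval (permShift (coord F) g.1.toAdd g.2)) (by
    intro a ha
    obtain ⟨b, rfl⟩ := Ideal.mem_span_singleton'.1 ha
    rw [map_mul]
    convert mul_zero _
    simpa [form] using sum_permShift_pow_three sum_coord_pow_three g.1.toAdd g.2)

theorem substHom_aeval (g : SymGroup) (p : MvPolynomial (Fin 4) F) :
    substHom F g (aeval (coord F) p) = aeval (permShift (coord F) g.1.toAdd g.2) p := by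
  rw [← mkₐ_eq_aeval]
  rfl

theorem substHom_coord (g : SymGroup) (i : Fin 4) :
    substHom F g (coord F i) = permShift (coord F) g.1.toAdd g.2 i := by
  simpa using substHom_aeval g (X i : MvPolynomial (Fin 4) F)

theorem substHom_mul (g h : SymGroup) :
    substHom F (g * h) = (substHom F g).comp (substHom F h) := by
  refine coordRing_algHom_ext fun i => ?_
  rw [AlgHom.comp_apply, substHom_coord, substHom_coord]
  rw [map_permShift]
  simp only [substHom_coord]
  exact (permShift_permShift (coord F) h.1.toAdd g.1.toAdd h.2 g.2 i).symm

theorem substHom_one : substHom F 1 = AlgHom.id F _ :=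
  coordRing_algHom_ext fun i => by
    rw [substHom_coord]
    simp [permShift]

theorem isHomogeneous_permShift_X {R : Type*} [CommRing R] (s : ZMod 2) (π : Equiv.Perm (Fin 4))
    (i : Fin 4) : (permShift (X : Fin 4 → MvPolynomial (Fin 4) R) s π i).IsHomogeneous 1 := by
  refine (isHomogeneous_X _ _).add ?_
  have h := (isHomogeneous_C (Fin 4) (ZMod.cast s : R)).mul
    (IsHomogeneous.sum Finset.univ (X : Fin 4 → MvPolynomial (Fin 4) R) 1
      fun i _ => isHomogeneous_X R i)
  rw [zero_add, ZMod.cast_eq_val, map_natCast, ← ZMod.cast_eq_val] at h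
  exact h

theorem substHom_mem_grading (g : SymGroup) {n : ℕ} {a : CoordRing F} (ha : a ∈ grading F n) :
    substHom F g a ∈ grading F n := by
  obtain ⟨p, hp, rfl⟩ := exists_of_mem_grading ha
  rw [substHom_aeval]
  have h1 := aeval_coord_mem_grading (hp.aeval _ (isHomogeneous_permShift_X (R := F) g.1.toAdd g.2))
  rw [one_mul] at h1
  convert h1 using 1
  rw [comp_aeval_apply]
  congr 2
  funext i
  rw [map_permShift]
  simp only [aeval_X]

variable (F) in
/-- The substitution as a homomorphism of graded rings. -/
def gradedSubst (g : SymGroup) : GradedRingHom (grading F) (grading F) where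
  __ := (substHom F g : CoordRing F →+* CoordRing F)
  map_mem := substHom_mem_grading g

theorem gradedSubst_apply (g : SymGroup) (a : CoordRing F) : gradedSubst F g a = substHom F g a :=
  rfl

theorem gradedSubst_mem (g : SymGroup) {n : ℕ} {a : CoordRing F} (ha : a ∈ grading F n) :
    gradedSubst F g a ∈ grading F n :=
  substHom_mem_grading g ha

theorem gradedSubst_mul (g h : SymGroup) :
    gradedSubst F (g * h) = (gradedSubst F g).comp (gradedSubst F h) :=
  GradedRingHom.ext fun a => DFunLike.congr_fun (substHom_mul g h) a

theorem gradedSubst_one : gradedSubst F 1 = GradedRingHom.id (grading F) :=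
  GradedRingHom.ext fun a => DFunLike.congr_fun substHom_one a

theorem irrelevant_le_map_gradedSubst (g : SymGroup) :
    HomogeneousIdeal.irrelevant (grading F) ≤
      (HomogeneousIdeal.irrelevant (grading F)).map (gradedSubst F g) := by
  rw [HomogeneousIdeal.irrelevant_le]
  intro i hi x hx
  have h : gradedSubst F g (gradedSubst F g⁻¹ x) = x := by
    have := GradedRingHom.congr_fun (gradedSubst_mul (F := F) g g⁻¹) x
    rw [mul_inv_cancel, gradedSubst_one] at this
    exact this.symm
  rw [← h]
  exact Ideal.mem_map_of_mem _ (HomogeneousIdeal.mem_irrelevant_of_mem _ hi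
    (substHom_mem_grading g⁻¹ hx))

variable (F) in
/-- The morphism of the surface induced by a substitution. -/
def surfaceMap (g : SymGroup) : Proj (grading F) ⟶ Proj (grading F) :=
  Proj.map (gradedSubst F g) (irrelevant_le_map_gradedSubst g)

theorem surfaceMap_mul (g h : SymGroup) :
    surfaceMap F (g * h) = surfaceMap F g ≫ surfaceMap F h := by
  rw [surfaceMap, surfaceMap, surfaceMap, ← Proj.map_comp]
  simp only [gradedSubst_mul]

theorem surfaceMap_one : surfaceMap F 1 = 𝟙 _ := by
  rw [surfaceMap, ← Proj.map_id]
  simp only [gradedSubst_one]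

theorem awayι_surfaceMap_structureMap (g : SymGroup) {n : ℕ} (hn : 0 < n) {a : CoordRing F}
    (ha : a ∈ grading F n) :
    Proj.awayι (grading F) (gradedSubst F g a) (gradedSubst_mem g ha) hn ≫
      surfaceMap F g ≫ structureMap F =
    Proj.awayι (grading F) (gradedSubst F g a) (gradedSubst_mem g ha) hn ≫
      structureMap F := by
  change _ ≫ _ ≫ Proj.toSpecZero (grading F) ≫ Spec.map _ =
    _ ≫ Proj.toSpecZero (grading F) ≫ Spec.map _
  rw [surfaceMap, Proj.awayι_comp_map_assoc _ _ hn _ ha, Proj.awayι_toSpecZero_assoc,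
    Proj.awayι_toSpecZero_assoc, ← Spec.map_comp, ← Spec.map_comp, ← Spec.map_comp]
  congr 1
  refine CommRingCat.hom_ext (RingHom.ext fun c => ?_)
  refine val_injective _ ?_
  change Localization.mk (substHom F g (algebraMap F (CoordRing F) c)) _ =
    Localization.mk (algebraMap F (CoordRing F) c) _
  rw [AlgHom.commutes]
  congr 1
  exact Subtype.ext (map_one (substHom F g))

theorem surfaceMap_structureMap (g : SymGroup) :
    surfaceMap F g ≫ structureMap F = structureMap F :=
  (Proj.mapAffineOpenCover (gradedSubst F g)
    (irrelevant_le_map_gradedSubst g)).openCover.hom_ext _ _ fun s =>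
      awayι_surfaceMap_structureMap g s.1.2 s.2.2

instance (g : SymGroup) : IsIso (surfaceMap F g) :=
  ⟨surfaceMap F g⁻¹, by rw [← surfaceMap_mul, mul_inv_cancel, surfaceMap_one],
    by rw [← surfaceMap_mul, inv_mul_cancel, surfaceMap_one]⟩

/-- The pullback of `xᵢ / x₃` is computed by substitution. -/
theorem funFieldToFrac_functionFieldMap (g : SymGroup) (i : Fin 4) :
    funFieldToFrac F ((functionFieldMap (surfaceMap F g)).hom (coordDiv F i 3)) =
      algebraMap _ (FracRing F) (permShift (coord F) g.1.toAdd g.2 i) /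
        algebraMap _ (FracRing F) (permShift (coord F) g.1.toAdd g.2 3) := by
  set φ := surfaceMap F g
  have hgen : genericPoint (Proj (grading F)) ∈
      φ ⁻¹ᵁ Proj.basicOpen (grading F) (coord F 3) := by
    have h := genericPoint_mem_basicOpen (F := F) 3
    rw [← genericPoint_eq_of_isOpenImmersion φ] at h
    exact h
  have h1 : (functionFieldMap φ).hom (coordDiv F i 3) = _ :=
    DFunLike.congr_fun (CommRingCat.hom_ext_iff.1 (functionFieldMap_germ φ _
      (genericPoint_mem_basicOpen (F := F) 3) hgen)) _
  have h2 : Proj.awayToSection (grading F) (coord F 3) ≫ φ.app _ =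
      CommRingCat.ofHom (Away.map (gradedSubst F g) (coord F 3)) ≫
        Proj.awayToSection (grading F) (gradedSubst F g (coord F 3)) := by
    rw [← Scheme.Hom.appLE_eq_app]
    exact Proj.awayToSection_comp_appLE (gradedSubst F g) (irrelevant_le_map_gradedSubst g)
      (coord_mem_grading 3)
  have h3 := DFunLike.congr_fun (CommRingCat.hom_ext_iff.1 h2)
    (Away.mk (grading F) (coord_mem_grading 3) 1 (coord F i) (coord_mem_grading i))
  have h4 := h3.trans (congrArg (Proj.awayToSection (grading F) _).hom
    (Away.map_mk (gradedSubst F g) (coord F 3) (coord_mem_grading 3) 1 (coord F i) (coord_mem_grading i)))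
  refine (congrArg (funFieldToFrac F) h1).trans ?_
  refine (congrArg (fun z => stalkToFrac _ ((Proj (grading F)).presheaf.germ _ _ hgen z))
    h4).trans ?_
  refine (stalkToFrac_germ _ _ hgen _).trans ?_
  rw [pow_one, gradedSubst_apply, gradedSubst_apply, substHom_coord, substHom_coord]

end Substitutions

/-! ### The automorphism group -/

section AutomorphismGroup

universe u

open MvPolynomial

variable {F : Type u} [Field F] [CharP F 2]

theorem functionFieldMap_surfaceMap_mul (g : SymGroup) (i : Fin 4) :
    (functionFieldMap (surfaceMap F g)).hom ((affineCoords F).r i) *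
        permShift (affineCoords F).r g.1.toAdd g.2 3 =
      permShift (affineCoords F).r g.1.toAdd g.2 i := by
  have h : ∀ i, funFieldToFrac F (permShift (affineCoords F).r g.1.toAdd g.2 i) =
      algebraMap _ (FracRing F) (permShift (coord F) g.1.toAdd g.2 i) * (fracCoord F 3)⁻¹ := by
    intro i
    rw [map_permShift, map_permShift, ← permShift_mul]
    congr 1
    funext j
    exact (funFieldToFrac_coordDiv j 3).trans (div_eq_mul_inv _ _)
  have h3 : algebraMap _ (FracRing F) (permShift (coord F) g.1.toAdd g.2 3) ≠ 0 := by
    rw [← substHom_coord, map_ne_zero_iff _ (IsFractionRing.injective (CoordRing F) (FracRing F))]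
    intro h0
    have h1 := DFunLike.congr_fun (substHom_mul (F := F) g⁻¹ g) (coord F 3)
    rw [inv_mul_cancel, substHom_one, AlgHom.comp_apply, h0, map_zero] at h1
    exact coord_ne_zero 3 h1
  refine funFieldToFrac_injective ?_
  rw [map_mul, h, h]
  refine (congrArg (· * _) (funFieldToFrac_functionFieldMap g i)).trans ?_
  rw [← mul_assoc, div_mul_cancel₀ _ h3]

/-- The group acts faithfully: fixing the ratios `xᵢ / x₃` gives quadratic relations between the
coordinates, which must hold between the variables already. -/
theorem eq_one_of_surfaceMap_eq_id {g : SymGroup} (hg : surfaceMap F g = 𝟙 _) : g = 1 := by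
  obtain ⟨s, π⟩ := g
  have hid : functionFieldMap (surfaceMap F (s, π)) = 𝟙 _ := by
    apply Spec.map_injective
    rw [← cancel_mono ((Proj (grading F)).fromSpecStalk _), SpecMap_functionFieldMap_fromSpecStalk,
      hg, Spec.map_id, Category.comp_id, Category.id_comp]
  have hpoly : ∀ i, X i * permShift (X : Fin 4 → MvPolynomial (Fin 4) F) s.toAdd π 3 =
      permShift (X : Fin 4 → MvPolynomial (Fin 4) F) s.toAdd π i * X 3 := by
    intro i
    have hhom := ((isHomogeneous_X F i).mul (isHomogeneous_permShift_X s.toAdd π 3)).sub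
      ((isHomogeneous_permShift_X s.toAdd π i).mul (isHomogeneous_X F 3))
    refine sub_eq_zero.1 (eq_zero_of_form_dvd (by norm_num) hhom
      (((affineCoords F).aeval_r_eq_zero_iff hhom).1 ?_))
    have h := functionFieldMap_surfaceMap_mul (F := F) (s, π) i
    rw [hid] at h
    rw [map_sub, map_mul, map_mul, map_permShift, map_permShift]
    simp only [aeval_X, (affineCoords F).r_three, mul_one]
    exact sub_eq_zero.2 h
  -- The value of the quadratic relations at the point `(0, 0, 0, 1)`.
  have heval : ∀ i, i ≠ 3 → (if π i = 3 then (1 : F) else 0) + ZMod.cast s.toAdd = 0 := by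
    intro i hi
    have h := congrArg (aeval (Pi.single 3 1 : Fin 4 → F)) (hpoly i)
    rw [map_mul, map_mul, map_permShift, map_permShift] at h
    simp only [aeval_X, permShift, Pi.single_apply, hi, if_false, zero_mul, if_true, mul_one,
      Finset.sum_ite_eq', Finset.mem_univ] at h
    exact h.symm
  have hs : s.toAdd = 0 := by
    obtain ⟨i, hi, hπi⟩ : ∃ i, i ≠ 3 ∧ π i ≠ 3 := by
      by_cases h0 : π 0 = 3
      · exact ⟨1, by decide, fun h1 => by simpa using π.injective (h0.trans h1.symm)⟩
      · exact ⟨0, by decide, h0⟩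
    have h := heval i hi
    rw [if_neg hπi, zero_add] at h
    exact (map_eq_zero (ZMod.castHom (dvd_refl 2) F)).1 h
  have hπ3 : π 3 = 3 := by
    by_contra hne
    have h := heval (π.symm 3) fun h => hne (by rw [← h, Equiv.apply_symm_apply, h])
    rw [hs, Equiv.apply_symm_apply, if_pos rfl, ZMod.cast_zero, add_zero] at h
    exact one_ne_zero h
  have hπ : π = 1 := by
    ext1 i
    have h := hpoly i
    simp only [permShift, hs, ZMod.cast_zero, zero_mul, add_zero, hπ3] at h
    exact (X_injective (mul_right_cancel₀ (X_ne_zero 3) h)).symm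
  exact Prod.ext hs hπ

variable (F) in
/-- The isomorphism induced by the inverse of a substitution. -/
def surfaceIso (g : SymGroup) : Proj (grading F) ≅ Proj (grading F) where
  hom := surfaceMap F g⁻¹
  inv := surfaceMap F g
  hom_inv_id := by rw [← surfaceMap_mul, inv_mul_cancel, surfaceMap_one]
  inv_hom_id := by rw [← surfaceMap_mul, mul_inv_cancel, surfaceMap_one]

variable (F) in
/-- The action of the group of obvious symmetries on the surface. A substitution acts on the
coordinates, hence contravariantly on the points, which is the reason for the inverse. -/
def symHom : SymGroup →* Aut (fermatCubic F) where
  toFun g := Over.isoMk (show (fermatCubic F).left ≅ (fermatCubic F).left from surfaceIso F g)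
    (surfaceMap_structureMap g⁻¹)
  map_one' := by
    ext
    exact (congrArg (surfaceMap F) inv_one).trans surfaceMap_one
  map_mul' g h := by
    ext
    exact (congrArg (surfaceMap F) (mul_inv_rev g h)).trans (surfaceMap_mul _ _)

theorem symHom_left (g : SymGroup) : (symHom F g).hom.left = surfaceMap F g⁻¹ := rfl

theorem symHom_injective : Function.Injective (symHom F) := by
  rw [injective_iff_map_eq_one]
  intro g hg
  have h : surfaceMap F g⁻¹ = 𝟙 _ := congrArg (fun f : Aut (fermatCubic F) => f.hom.left) hg
  exact inv_eq_one.1 (eq_one_of_surfaceMap_eq_id h)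

theorem symHom_surjective {k : ℕ} (hF : Nat.card F = 2 ^ (2 * k + 1)) :
    Function.Surjective (symHom F) := by
  intro f
  let φ : Proj (grading F) ⟶ Proj (grading F) := f.hom.left
  have hφ : IsIso φ := ((Over.forget _).mapIso f).isIso_hom
  have hover : φ ≫ structureMap F = structureMap F := Over.w f.hom
  let σ : FunField F ≃ₐ[F] FunField F := AlgEquiv.ofBijective
    { (functionFieldMap φ).hom with commutes' := functionFieldMap_algebraMap φ hover }
    (functionFieldMap_bijective φ)
  obtain ⟨s, π, hne, h⟩ := (affineCoords F).exists_permShift isLocalRingFamily_localSubring hF σ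
    fun x => ⟨φ x, functionFieldMap_mem_localSubring_iff φ x⟩
  refine ⟨(Multiplicative.ofAdd s, π)⁻¹, ?_⟩
  ext
  rw [symHom_left, inv_inv]
  refine eq_of_functionFieldMap_eq (ψ := φ) (CommRingCat.hom_ext
    ((affineCoords F).ringHom_ext (functionFieldMap_algebraMap _ (surfaceMap_structureMap _))
      (functionFieldMap_algebraMap φ hover) fun i => ?_))
  exact mul_right_cancel₀ hne ((functionFieldMap_surfaceMap_mul
    ((Multiplicative.ofAdd s, π) : SymGroup) i).trans (h i).symm)

end AutomorphismGroup

end FermatCubic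

end

theorem proposition1p6 (k : ℕ) (F : Type*) [Field F] (hF : Nat.card F = 2 ^ (2 * k + 1)) :
    Nonempty (Aut (fermatCubic F) ≃* Multiplicative (ZMod 2) × Equiv.Perm (Fin 4)) := by
  have := FermatCubic.charP_two_of_card hF
  exact ⟨(MulEquiv.ofBijective (FermatCubic.symHom F)
    ⟨FermatCubic.symHom_injective, FermatCubic.symHom_surjective hF⟩).symm⟩
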